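/- Let $H^2_8$ be the black/white equilateral triangle lattice of the hyperbolic plane: the oriented triangulation of the plane with exactly $8$ triangles at every vertex, with its triangles colored black and white so that triangles with a common edge have different colors. Distances between vertices count edges. An oriented edge path $\gamma$ is called right-convex if at each of its vertices there are exactly two or exactly three triangles on its right side (for a closed path this is required at all vertices; for an open path, which is assumed to have at least two edges, at all vertices except the two ends). Let $|\gamma|$ denote the number of edges of a finite path. The shift $T(\gamma)$ of $\gamma$ to the left by one is the path formed, in the order along $\gamma$, by the edges opposite to $x$ in the triangles at $x$ which lie on the left side of $\gamma$ and have no edge in common with the two edges of $\gamma$ that meet at $x$, where $x$ runs over the vertices of $\gamma$ (over the vertices other than the two ends, if $\gamma$ is open). Put $\lambda=2+\sqrt3$. **Theorem.** Let $\gamma$ be a finite right-convex path, closed or open. Then all the paths $T^n(\gamma)$, $n\ge 0$, are right-convex, and their size grows asymptotically by the factor $\lambda$ in each step: $$|T^{n+1}(\gamma)|\sim\lambda\,|T^n(\gamma)|\qquad(n\to\infty);$$ more precisely, there is a constant $c=c(\gamma)>0$ with $|T^n(\gamma)|\sim c\,\lambda^n$ as $n\to\infty$. In particular, let $o$ be a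 vertex, and let $\partial D_r$ be the boundary of the ball $D_r$ of radius $r$ with center $o$, that is, the set of vertices at distance $r$ from $o$. There is a right-convex closed path $\gamma$ such that, for all $n\ge0$, the path $T^n(\gamma)$ passes exactly once through each vertex of $\partial D_{n+1}$ and through no other vertex. The sets $\partial D_r$ are finite and non-empty, and $$|\partial D_{r+1}|\sim\lambda\,|\partial D_r|\qquad(r\to\infty).$$ Moreover $|\partial D_r|\sim\lambda^{r-k}|\partial D_k|$ in the following sense: for every $k\ge1$ the ratio $|\partial D_r|/(\lambda^{r-k}|\partial D_k|)$ has a positive finite limit as $r\to\infty$, and this ratio tends to $1$ as $k\to\infty$, uniformly in $r\ge k$. -/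

import Mathlib

open Filter Asymptotics

/-- An oriented triangulated surface without boundary, presented by its set `D` of darts (oriented
edges). `rev d` is the edge `d` with the opposite orientation, and `rot d` is the next dart after
`d` in counterclockwise order around the origin of `d`. The triangle on the left of `d` has the
boundary `d`, `next d`, `next (next d)`, where `next d = rot⁻¹ (rev d)`. -/
structure TriangulatedSurface (D : Type*) where
  rot : Equiv.Perm D
  rev : Equiv.Perm D
  rev_rev : ∀ d, rev (rev d) = d
  rev_ne : ∀ d, rev d ≠ d
  three_sides : ∀ d, Function.minimalPeriod (fun e => rot.symm (rev e)) d = 3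

namespace TriangulatedSurface

variable {D : Type*} (M : TriangulatedSurface D)

/-- The next side, counterclockwise, of the triangle on the left of `d`. -/
def next (d : D) : D := M.rot.symm (M.rev d)

/-- The vertices: a vertex is the set of all darts that start at it. -/
def Vertex : Type _ := Quotient (Equiv.Perm.SameCycle.setoid M.rot)

/-- The starting point of a dart. -/
def origin (d : D) : M.Vertex := Quotient.mk (Equiv.Perm.SameCycle.setoid M.rot) d

/-- The end point of a dart. -/
def target (d : D) : M.Vertex := M.origin (M.rev d)

/-- The graph of vertices and edges; `M.graph.dist` is the distance that counts edges. -/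
def graph : SimpleGraph M.Vertex :=
  SimpleGraph.fromRel fun v w => ∃ d, M.origin d = v ∧ M.target d = w

/-- `M.IsPath v w l`: the list `l` of darts is an edge path from `v` to `w`. -/
def IsPath : M.Vertex → M.Vertex → List D → Prop
  | v, w, [] => v = w
  | v, w, d :: l => M.origin d = v ∧ IsPath (M.target d) w l

/-- `l'` is obtained from `l` by removing an edge that is traversed back and forth, or by removing
the boundary of a triangle. -/
def Reduces (l l' : List D) : Prop :=
  ∃ (p q : List D) (d : D), l' = p ++ q ∧
    (l = p ++ [d, M.rev d] ++ q ∨ l = p ++ [d, M.next d, M.next (M.next d)] ++ q)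

/-- Homotopy, with fixed end points, of edge paths from `v` to `w`. -/
def Homotopic (v w : M.Vertex) : List D → List D → Prop :=
  Relation.EqvGen fun l l' => M.IsPath v w l ∧ M.IsPath v w l' ∧ M.Reduces l l'

/-- Every closed edge path is homotopic to a constant path. -/
def SimplyConnected : Prop :=
  ∀ (v : M.Vertex) (l : List D), M.IsPath v v l → M.Homotopic v v l []

end TriangulatedSurface

/-- A black/white triangulation of the plane (a connected and simply connected triangulated
surface) with `m` triangles at each vertex. `black d` says that the triangle on the left of `d` is
black; triangles with a common side have different colors. For `m = 8` this is the black/white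
equilateral triangle lattice of the hyperbolic plane. -/
structure BWLattice (m : ℕ) (D : Type*) extends TriangulatedSurface D where
  degree : ∀ d, Function.minimalPeriod rot d = m
  connected : toTriangulatedSurface.graph.Connected
  simplyConnected : toTriangulatedSurface.SimplyConnected
  black : D → Prop
  black_next : ∀ d, black (toTriangulatedSurface.next d) ↔ black d
  black_rev : ∀ d, black (rev d) ↔ ¬ black d

namespace BWLattice

variable {m : ℕ} {D : Type*} (L : BWLattice m D)

open Classical in
/-- For two darts `a`, `b` with the same origin `x`: the triangles at `x` in the sector that is
swept by turning counterclockwise from `a` to `b`, in this order. Each triangle is represented by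
its side that starts at `x` and has the triangle on its left. -/
noncomputable def sector (a b : D) : List D :=
  (List.iterate L.rot a m).takeWhile fun e => e ≠ b

/-- The triangles on the right side of a path which arrives by `d` and leaves by `e`. -/
noncomputable def rightTriangles (d e : D) : List D := L.sector (L.rev d) e

/-- The triangles on the left side of a path which arrives by `d` and leaves by `e`, in
counterclockwise order: the first contains the edge `e`, the last contains the edge `d`. -/
noncomputable def leftTriangles (d e : D) : List D := L.sector e (L.rev d)

/-- The corners of a path: the pairs of consecutive edges. -/
def corners (γ : List D) : List (D × D) := γ.zip γ.tail

/-- The corners of a closed path, in which the first edge comes after the last one. -/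
def cyclicCorners (γ : List D) : List (D × D) := γ.zip (γ.rotate 1)

/-- The edges join at a corner, and two or three triangles are on the right side there. -/
def ConvexCorner (c : D × D) : Prop :=
  L.target c.1 = L.origin c.2 ∧
    ((L.rightTriangles c.1 c.2).length = 2 ∨ (L.rightTriangles c.1 c.2).length = 3)

/-- Right-convex closed paths, given by the cyclic list of their edges. -/
def IsRightConvexClosed (γ : List D) : Prop :=
  γ ≠ [] ∧ ∀ c ∈ cyclicCorners γ, L.ConvexCorner c

/-- Right-convex open paths, given by the list of their edges. There are at least two of them, so
that there is a corner, and the condition is imposed at all vertices except for the two ends. -/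
def IsRightConvexOpen (γ : List D) : Prop :=
  2 ≤ γ.length ∧ ∀ c ∈ corners γ, L.ConvexCorner c

/-- The part of the shifted path that is produced by a corner at `x`: among the triangles at `x` on
the left side, drop the first and the last, which have an edge on the path, and take in each of the
others the edge opposite to `x`, oriented so that the triangle is on its right. The order is the
order along the path. -/
noncomputable def shiftCorner (c : D × D) : List D :=
  ((L.leftTriangles c.1 c.2).tail.dropLast.reverse).map fun e => L.rev (L.next e)

/-- The shift `T(γ)` of a closed path to the left by one. -/
noncomputable def shiftClosed (γ : List D) : List D :=
  (cyclicCorners γ).flatMap L.shiftCorner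

/-- The shift `T(γ)` of an open path to the left by one. -/
noncomputable def shiftOpen (γ : List D) : List D :=
  (corners γ).flatMap L.shiftCorner

/-- The boundary `∂D_r` of the ball `D_r` with center `o`: the vertices at distance `r` from `o`. -/
def sphere (o : L.Vertex) (r : ℕ) : Set L.Vertex := {v | L.graph.dist o v = r}

/-- The closed path `γ` visits each vertex of `S` exactly once, and no other vertex. -/
def Traverses (γ : List D) (S : Set L.Vertex) : Prop :=
  (γ.map L.origin).Nodup ∧ {v | v ∈ γ.map L.origin} = S

end BWLattice

namespace TriangulatedSurface

variable {D : Type*} (M : TriangulatedSurface D)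

theorem isPath_append {u v w : M.Vertex} {p q : List D} (hp : M.IsPath u v p)
    (hq : M.IsPath v w q) : M.IsPath u w (p ++ q) := by
  induction p generalizing u with
  | nil => cases hp; exact hq
  | cons d p ih => exact ⟨hp.1, ih hp.2⟩

theorem Homotopic.append_left {u v w : M.Vertex} {p l l' : List D} (hp : M.IsPath u v p)
    (h : M.Homotopic v w l l') : M.Homotopic u w (p ++ l) (p ++ l') := by
  induction h with
  | rel x y h =>
    obtain ⟨hx, hy, a, b, d, rfl, h⟩ := h
    refine .rel _ _ ⟨M.isPath_append hp hx, M.isPath_append hp hy, p ++ a, b, d, by simp, ?_⟩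
    rcases h with rfl | rfl
    · exact Or.inl (by simp)
    · exact Or.inr (by simp)
  | refl x => exact .refl _
  | symm x y _ ih => exact .symm _ _ ih
  | trans x y z _ _ h1 h2 => exact .trans _ _ _ h1 h2

theorem Homotopic.append_right {u v w : M.Vertex} {q l l' : List D} (hq : M.IsPath v w q)
    (h : M.Homotopic u v l l') : M.Homotopic u w (l ++ q) (l' ++ q) := by
  induction h with
  | rel x y h =>
    obtain ⟨hx, hy, a, b, d, rfl, h⟩ := h
    refine .rel _ _ ⟨M.isPath_append hx hq, M.isPath_append hy hq, a, b ++ q, d, by simp, ?_⟩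
    rcases h with rfl | rfl
    · exact Or.inl (by simp)
    · exact Or.inr (by simp)
  | refl x => exact .refl _
  | symm x y _ ih => exact .symm _ _ ih
  | trans x y z _ _ h1 h2 => exact .trans _ _ _ h1 h2

theorem target_rev (d : D) : M.target (M.rev d) = M.origin d := by
  rw [target, M.rev_rev]

theorem exists_inverse {u v : M.Vertex} {p : List D} (hp : M.IsPath u v p) :
    ∃ q, M.IsPath v u q ∧ M.Homotopic v v (q ++ p) [] := by
  induction p generalizing u with
  | nil => cases hp; exact ⟨[], rfl, .refl _⟩
  | cons d p ih =>
    obtain ⟨q, hq, h⟩ := ih hp.2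
    obtain ⟨rfl, hp⟩ := hp
    refine ⟨q ++ [M.rev d], M.isPath_append hq ⟨rfl, M.target_rev d⟩, ?_⟩
    refine .trans _ _ _ (.rel _ _ ⟨?_, M.isPath_append hq hp, q, p, M.rev d, rfl, ?_⟩) h
    · exact M.isPath_append (M.isPath_append hq ⟨rfl, M.target_rev d⟩) ⟨rfl, hp⟩
    · exact Or.inl (by simp [M.rev_rev])

theorem origin_rot (d : D) : M.origin (M.rot d) = M.origin d :=
  Quotient.sound (s := Equiv.Perm.SameCycle.setoid M.rot) ⟨-1, by simp⟩

theorem origin_next (d : D) : M.origin (M.next d) = M.target d := by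
  rw [target, ← M.origin_rot (M.next d), next, Equiv.apply_symm_apply]

end TriangulatedSurface

namespace TriangleGroup

/-- The relations of the rotation group of the lattice: `false` is the rotation about a vertex,
`true` is the half-turn about the midpoint of an edge. -/
def rels : Set (FreeGroup Bool) :=
  {FreeGroup.of false ^ 8, FreeGroup.of true ^ 2, ((FreeGroup.of false)⁻¹ * FreeGroup.of true) ^ 3}

/-- The rotation group of the lattice. -/
abbrev G : Type := PresentedGroup rels

def s : G := PresentedGroup.of false

def a : G := PresentedGroup.of true

theorem s_pow : s ^ 8 = 1 :=
  PresentedGroup.one_of_mem (rels := rels) (x := FreeGroup.of false ^ 8) (by simp [rels])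

theorem a_pow : a ^ 2 = 1 :=
  PresentedGroup.one_of_mem (rels := rels) (x := FreeGroup.of true ^ 2) (by simp [rels])

theorem sa_pow : (s⁻¹ * a) ^ 3 = 1 :=
  PresentedGroup.one_of_mem (rels := rels)
    (x := ((FreeGroup.of false)⁻¹ * FreeGroup.of true) ^ 3) (by simp [rels])

theorem a_mul_a (g : G) : a * (a * g) = g := by
  rw [← mul_assoc, ← pow_two, a_pow, one_mul]

theorem lift_rels {H : Type*} [Group H] (x y : H) (hx : x ^ 8 = 1) (hy : y ^ 2 = 1)
    (hxy : (x⁻¹ * y) ^ 3 = 1) :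
    ∀ r ∈ rels, FreeGroup.lift (fun b : Bool => cond b y x) r = 1 := by
  rintro r (rfl | rfl | rfl) <;> simp [hx, hy, hxy]

/-- The homomorphism to a group in which the relations hold. -/
def lift {H : Type*} [Group H] (x y : H) (hx : x ^ 8 = 1) (hy : y ^ 2 = 1)
    (hxy : (x⁻¹ * y) ^ 3 = 1) : G →* H :=
  PresentedGroup.toGroup (lift_rels x y hx hy hxy)

section lift

variable {H : Type*} [Group H] (x y : H) (hx : x ^ 8 = 1) (hy : y ^ 2 = 1)
    (hxy : (x⁻¹ * y) ^ 3 = 1)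

theorem lift_s : lift x y hx hy hxy s = x := PresentedGroup.toGroup.of _

theorem lift_a : lift x y hx hy hxy a = y := PresentedGroup.toGroup.of _

end lift

theorem induction {P : G → Prop} (h1 : P 1) (hs : ∀ g, P g → P (s * g))
    (ha : ∀ g, P g → P (a * g)) (g : G) : P g := by
  have hn : ∀ n : ℕ, ∀ g, P g → P (s ^ n * g) := by
    intro n
    induction n with
    | zero => simp
    | succ n ih => intro g hg; rw [pow_succ, mul_assoc]; exact ih _ (hs g hg)
  have hs' : s⁻¹ = s ^ 7 := inv_eq_of_mul_eq_one_right (by rw [← pow_succ']; exact s_pow)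
  have ha' : a⁻¹ = a := inv_eq_of_mul_eq_one_right (by rw [← pow_two]; exact a_pow)
  have hg : g ∈ Subgroup.closure (Set.range (PresentedGroup.of (rels := rels))) := by
    rw [PresentedGroup.closure_range_of]; trivial
  induction hg using Subgroup.closure_induction_left with
  | one => exact h1
  | mul_left x hx y _ ih =>
    obtain ⟨b, rfl⟩ := hx
    cases b
    · exact hs _ ih
    · exact ha _ ih
  | inv_mul_cancel x hx y _ ih =>
    obtain ⟨b, rfl⟩ := hx
    cases b
    · change P (s⁻¹ * y); rw [hs']; exact hn 7 _ ih
    · change P (a⁻¹ * y); rw [ha']; exact ha _ ih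

def permS : Equiv.Perm (Fin 8) := finRotate 8

def permA : Equiv.Perm (Fin 8) := Equiv.swap 2 7 * Equiv.swap 3 4 * Equiv.swap 5 6

def toPerm : G →* Equiv.Perm (Fin 8) :=
  lift permS permA (by decide) (by decide) (by decide)

theorem toPerm_s : toPerm s = permS := lift_s ..

theorem toPerm_a : toPerm a = permA := lift_a ..

theorem ne_one_of_toPerm {g : G} (h : toPerm g ≠ 1) : g ≠ 1 := fun hg => h (by rw [hg, map_one])

theorem iterate_mul (x g : G) (n : ℕ) : (fun e => x * e)^[n] g = x ^ n * g := by
  rw [mul_left_iterate]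

/-- The surface with one dart for each rotation. -/
def surface : TriangulatedSurface G where
  rot := Equiv.mulLeft s
  rev := Equiv.mulLeft a
  rev_rev d := a_mul_a d
  rev_ne d h := ne_one_of_toPerm (g := a) (by rw [toPerm_a]; decide) (mul_eq_right.1 h)
  three_sides d := by
    have : (fun e => (Equiv.mulLeft s).symm ((Equiv.mulLeft a) e)) = fun e => (s⁻¹ * a) * e := by
      funext e; simp [mul_assoc]
    rw [this]
    have : Fact (Nat.Prime 3) := ⟨Nat.prime_three⟩
    refine Function.minimalPeriod_eq_prime ?_ ?_
    · rw [Function.IsPeriodicPt, Function.IsFixedPt, iterate_mul, sa_pow, one_mul]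
    · intro h
      refine ne_one_of_toPerm (g := s⁻¹ * a) ?_ (mul_eq_right.1 h)
      rw [map_mul, map_inv, toPerm_s, toPerm_a]; decide

theorem rot_apply (d : G) : surface.rot d = s * d := rfl

theorem rev_apply (d : G) : surface.rev d = a * d := rfl

theorem next_apply (d : G) : surface.next d = s⁻¹ * (a * d) := rfl

theorem origin_s (d : G) : surface.origin (s * d) = surface.origin d := surface.origin_rot d

theorem origin_s_inv (d : G) : surface.origin (s⁻¹ * d) = surface.origin d := by
  rw [← origin_s, mul_inv_cancel_left]

theorem origin_s_pow (n : ℕ) (d : G) : surface.origin (s ^ n * d) = surface.origin d := by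
  induction n with
  | zero => rw [pow_zero, one_mul]
  | succ n ih => rw [pow_succ', mul_assoc, origin_s, ih]

theorem origin_a (d : G) : surface.origin (a * d) = surface.target d := rfl

theorem connected : surface.graph.Connected := by
  have h : ∀ g, surface.graph.Reachable (surface.origin 1) (surface.origin g) := by
    intro g
    induction g using induction with
    | h1 => exact .refl _
    | hs g ih => rwa [origin_s]
    | ha g ih =>
      by_cases hg : surface.origin g = surface.origin (a * g)
      · rwa [← hg]
      · exact ih.trans (SimpleGraph.Adj.reachable ⟨hg, Or.inl ⟨g, rfl, rfl⟩⟩)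
  have : Nonempty surface.Vertex := ⟨surface.origin 1⟩
  refine ⟨fun v w => ?_⟩
  obtain ⟨g, rfl⟩ := Quotient.exists_rep v
  obtain ⟨k, rfl⟩ := Quotient.exists_rep w
  exact (h g).symm.trans (h k)

/-- A dart with a path that leads to it. -/
abbrev Lead : Type := {x : G × List G // surface.IsPath (surface.origin 1) (surface.origin x.1) x.2}

instance leadSetoid : Setoid Lead where
  r x y := x.1.1 = y.1.1 ∧
    surface.Homotopic (surface.origin 1) (surface.origin x.1.1) x.1.2 y.1.2
  iseqv :=
    { refl := fun _ => ⟨rfl, .refl _⟩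
      symm := fun h => ⟨h.1.symm, h.1 ▸ .symm _ _ h.2⟩
      trans := fun h k => ⟨h.1.trans k.1, .trans _ _ _ h.2 (h.1 ▸ k.2)⟩ }

def leadS (x : Lead) : Lead := ⟨(s * x.1.1, x.1.2), by rw [origin_s]; exact x.2⟩

def leadS' (x : Lead) : Lead :=
  ⟨(s⁻¹ * x.1.1, x.1.2), by rw [origin_s_inv]; exact x.2⟩

def leadA (x : Lead) : Lead :=
  ⟨(a * x.1.1, x.1.2 ++ [x.1.1]), surface.isPath_append x.2 ⟨rfl, rfl⟩⟩

theorem leadS_congr {x y : Lead} (h : x ≈ y) : leadS x ≈ leadS y :=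
  ⟨congrArg (s * ·) h.1, by change surface.Homotopic _ (surface.origin (s * _)) _ _
                            rw [origin_s]; exact h.2⟩

theorem leadS'_congr {x y : Lead} (h : x ≈ y) : leadS' x ≈ leadS' y :=
  ⟨congrArg (s⁻¹ * ·) h.1, by change surface.Homotopic _ (surface.origin (s⁻¹ * _)) _ _
                              rw [origin_s_inv]; exact h.2⟩

theorem leadA_congr {x y : Lead} (h : x ≈ y) : leadA x ≈ leadA y := by
  refine ⟨congrArg (a * ·) h.1, ?_⟩
  have h1 := h.1
  change surface.Homotopic _ (surface.origin (a * x.1.1)) (x.1.2 ++ [x.1.1]) (y.1.2 ++ [y.1.1])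
  rw [← h1]
  exact TriangulatedSurface.Homotopic.append_right surface ⟨rfl, rfl⟩ h.2

theorem leadA_leadA (x : Lead) : leadA (leadA x) ≈ x := by
  refine ⟨a_mul_a _, .rel _ _ ⟨(leadA (leadA x)).2, ?_, x.1.2, [], x.1.1, by simp, Or.inl ?_⟩⟩
  · change surface.IsPath _ (surface.origin (a * (a * x.1.1))) _
    rw [a_mul_a]; exact x.2
  · simp [leadA, rev_apply]

def liftS : Equiv.Perm (Quotient leadSetoid) where
  toFun := Quotient.map leadS fun _ _ => leadS_congr
  invFun := Quotient.map leadS' fun _ _ => leadS'_congr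
  left_inv := by
    rintro ⟨x⟩
    exact congrArg (Quotient.mk leadSetoid) (Subtype.ext (Prod.ext (inv_mul_cancel_left _ _) rfl))
  right_inv := by
    rintro ⟨x⟩
    exact congrArg (Quotient.mk leadSetoid) (Subtype.ext (Prod.ext (mul_inv_cancel_left _ _) rfl))

def liftA : Equiv.Perm (Quotient leadSetoid) where
  toFun := Quotient.map leadA fun _ _ => leadA_congr
  invFun := Quotient.map leadA fun _ _ => leadA_congr
  left_inv := by rintro ⟨x⟩; exact Quotient.sound (leadA_leadA x)
  right_inv := by rintro ⟨x⟩; exact Quotient.sound (leadA_leadA x)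

theorem liftS_pow (n : ℕ) (x : Lead) (h : surface.IsPath (surface.origin 1)
    (surface.origin (s ^ n * x.1.1)) x.1.2) :
    (liftS ^ n) (Quotient.mk _ x) = Quotient.mk _ ⟨(s ^ n * x.1.1, x.1.2), h⟩ := by
  induction n with
  | zero => exact congrArg (Quotient.mk leadSetoid) (Subtype.ext (Prod.ext (by simp) rfl))
  | succ n ih =>
    have h' : surface.IsPath (surface.origin 1) (surface.origin (s ^ n * x.1.1)) x.1.2 := by
      rw [origin_s_pow] at h ⊢; exact h
    rw [pow_succ', Equiv.Perm.mul_apply, ih h']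
    exact congrArg (Quotient.mk leadSetoid) (Subtype.ext (Prod.ext (by
      change s * (s ^ n * x.1.1) = s ^ (n + 1) * x.1.1
      rw [pow_succ', mul_assoc]) rfl))

theorem liftS_pow_eight : liftS ^ 8 = 1 := by
  ext ⟨x⟩
  refine (liftS_pow 8 x (by rw [s_pow, one_mul]; exact x.2)).trans ?_
  exact congrArg (Quotient.mk leadSetoid) (Subtype.ext (Prod.ext (by simp [s_pow]) rfl))

theorem liftA_pow_two : liftA ^ 2 = 1 := by
  ext ⟨x⟩
  exact Quotient.sound (leadA_leadA x)

theorem liftSA_pow_three : (liftS⁻¹ * liftA) ^ 3 = 1 := by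
  ext ⟨x⟩
  refine Quotient.sound (s := leadSetoid)
    (a := leadS' (leadA (leadS' (leadA (leadS' (leadA x)))))) ?_
  have h : s⁻¹ * (a * (s⁻¹ * (a * (s⁻¹ * (a * x.1.1))))) = x.1.1 := by
    have := congrArg (· * x.1.1) sa_pow
    simpa [pow_succ, mul_assoc] using this
  refine ⟨h, .rel _ _ ⟨(leadS' (leadA (leadS' (leadA (leadS' (leadA x)))))).2, ?_, x.1.2, [], x.1.1,
    by simp, Or.inr ?_⟩⟩
  · change surface.IsPath _ (surface.origin (s⁻¹ * (a * (s⁻¹ * (a * (s⁻¹ * (a * x.1.1))))))) _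
    rw [h]; exact x.2
  · simp [leadA, leadS', next_apply]

/-- The action of the group on the homotopy classes of paths. -/
def act : G →* Equiv.Perm (Quotient leadSetoid) :=
  lift liftS liftA liftS_pow_eight liftA_pow_two liftSA_pow_three

def base : Lead := ⟨(1, []), rfl⟩

/-- `p` represents the class of paths that is attached to `g`. -/
def Rep (g : G) (p : List G) : Prop :=
  ∃ h, act g (Quotient.mk _ base) = Quotient.mk leadSetoid ⟨(g, p), h⟩

theorem Rep.s {g : G} {p : List G} (h : Rep g p) : Rep (s * g) p := by
  obtain ⟨h, e⟩ := h
  refine ⟨by rw [origin_s]; exact h, ?_⟩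
  rw [map_mul, Equiv.Perm.mul_apply, e, act, lift_s]; rfl

theorem Rep.a {g : G} {p : List G} (h : Rep g p) : Rep (a * g) (p ++ [g]) := by
  obtain ⟨h, e⟩ := h
  refine ⟨surface.isPath_append h ⟨rfl, rfl⟩, ?_⟩
  rw [map_mul, Equiv.Perm.mul_apply, e, act, lift_a]; rfl

theorem exists_rep (g : G) : ∃ p, Rep g p := by
  induction g using induction with
  | h1 => exact ⟨[], rfl, by rw [map_one]; rfl⟩
  | hs g ih => exact ih.imp fun _ h => h.s
  | ha g ih => obtain ⟨p, h⟩ := ih; exact ⟨_, h.a⟩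

theorem Rep.homotopic {g : G} {p q : List G} (hp : Rep g p) (hq : Rep g q) :
    surface.Homotopic (surface.origin 1) (surface.origin g) p q := by
  obtain ⟨_, h⟩ := hp
  obtain ⟨_, k⟩ := hq
  exact (Quotient.exact (h.symm.trans k)).2

theorem Rep.of_origin {g k : G} {p : List G} (h : Rep g p)
    (e : surface.origin g = surface.origin k) : Rep k p := by
  have hn : ∀ n : ℕ, Rep (TriangleGroup.s ^ n * g) p := by
    intro n
    induction n with
    | zero => simpa using h
    | succ n ih => rw [pow_succ', mul_assoc]; exact ih.s
  obtain ⟨i, rfl⟩ : Equiv.Perm.SameCycle surface.rot g k := Quotient.exact e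
  have hi : (surface.rot ^ i) g = TriangleGroup.s ^ i * g := by
    have : surface.rot = MulAction.toPermHom G G TriangleGroup.s := rfl
    rw [this, ← map_zpow]; rfl
  have h8 : TriangleGroup.s ^ i = TriangleGroup.s ^ (i % 8).toNat := by
    rw [← zpow_natCast, Int.toNat_of_nonneg (Int.emod_nonneg _ (by norm_num))]
    exact zpow_eq_zpow_emod' i s_pow
  rw [hi, h8]; exact hn _

theorem Rep.path {g k : G} {p l : List G} (h : Rep g p)
    (hl : surface.IsPath (surface.origin g) (surface.origin k) l) : Rep k (p ++ l) := by
  induction l generalizing g p with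
  | nil => rw [List.append_nil]; exact h.of_origin hl
  | cons d l ih =>
    have := ih (h.of_origin hl.1.symm).a hl.2
    rwa [List.append_assoc] at this

theorem simplyConnected : surface.SimplyConnected := by
  intro v l hl
  obtain ⟨g, rfl⟩ := Quotient.exists_rep v
  change surface.IsPath (surface.origin g) (surface.origin g) l at hl
  change surface.Homotopic (surface.origin g) (surface.origin g) l []
  obtain ⟨p, hp⟩ := exists_rep g
  obtain ⟨hp', -⟩ := id hp
  obtain ⟨q, hq, e⟩ := surface.exists_inverse hp'
  have h1 := TriangulatedSurface.Homotopic.append_left surface hq ((hp.path hl).homotopic hp)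
  have h2 := TriangulatedSurface.Homotopic.append_right surface hl e
  rw [List.append_assoc] at h2
  exact .trans _ _ _ (.symm _ _ h2) (.trans _ _ _ h1 e)

theorem sign_s : Equiv.Perm.sign (toPerm s) = -1 := by rw [toPerm_s]; decide

theorem sign_a : Equiv.Perm.sign (toPerm a) = -1 := by rw [toPerm_a]; decide

/-- The lattice exists: it is built from its rotation group. -/
def lattice : BWLattice 8 G where
  toTriangulatedSurface := surface
  degree d := by
    change Function.minimalPeriod (fun e => s * e) d = 2 ^ (2 + 1)
    have : Fact (Nat.Prime 2) := ⟨Nat.prime_two⟩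
    refine Function.minimalPeriod_eq_prime_pow ?_ ?_
    · rw [Function.IsPeriodicPt, Function.IsFixedPt, iterate_mul]
      intro h
      refine ne_one_of_toPerm (g := s ^ 2 ^ 2) ?_ (mul_eq_right.1 h)
      rw [map_pow, toPerm_s]; decide
    · rw [Function.IsPeriodicPt, Function.IsFixedPt, iterate_mul]
      change s ^ 8 * d = d
      rw [s_pow, one_mul]
  connected := connected
  simplyConnected := simplyConnected
  black d := Equiv.Perm.sign (toPerm d) = 1
  black_next d := by
    simp [next_apply, map_mul, map_inv, sign_s, sign_a]
  black_rev d := by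
    rw [rev_apply, map_mul, map_mul, sign_a]
    rcases Int.units_eq_one_or (Equiv.Perm.sign (toPerm d)) with h | h <;> rw [h] <;> decide

end TriangleGroup

/-! Growth. The corners of a shifted path are determined by the old path. Two consecutive new edges
opposite to the same vertex `x` meet with exactly two triangles on the right, namely those on both
sides of the edge from `x` to their common point. Where the fans of two neighboring vertices `x`,
`y` meet, there are exactly three: the triangle on the left of the edge `xy` and one from each fan.
So the shift is again right-convex. Of the eight triangles at a corner, those on the right and the
two extreme ones on the left are discarded, so a corner with two triangles on the right yields four
new edges and a corner with three yields three. Each edge of a closed path thus creates one corner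
of the second kind, and the lengths satisfy `l (n + 2) = 4 * l (n + 1) - l n`; for an open path `l -
1` satisfies it. The larger root of `x ^ 2 = 4 * x - 1` is `2 + √3`, and its coefficient is positive
because the lengths do not decrease in the first step. The lemmas are `shiftOpen_of_isChain`,
`IsRightConvexClosed.shift` and `asymptotics_of_recurrence`.

Spheres. It remains to see that the shifts of the circuit around `o` run through the spheres without
repetition. The type `Node` is a tree-like model of the lattice, organized in concentric circles on
which successor, reversal and distance to the center are explicit. It maps to the lattice compatibly
with rotation and reversal (`placeDart_flip`) and bijectively on the eight darts at each vertex, so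
it is a covering. Paths lift, homotopic paths have lifts with the same end, and simple connectivity
makes the map injective on vertices (`placeVertex_injective`); connectivity makes it surjective.
Hence model radius equals graph distance (`dist_placeVertex`), and the model circles are carried to
the iterated shifts (`shiftClosed_circlePath`). -/

/-! ### Asymptotics of the linear recurrence -/

theorem exists_tendsto_div_pow_of_recurrence {u : ℕ → ℝ}
    (h : ∀ n, u (n + 2) = 4 * u (n + 1) - u n) (h0 : 0 < u 0) (h1 : u 0 ≤ u 1) :
    ∃ c : ℝ, 0 < c ∧ Tendsto (fun n => u n / (2 + √3) ^ n) atTop (nhds c) := by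
  have hs : √3 * √3 = 3 := Real.mul_self_sqrt (by norm_num)
  have hs0 : 0 < √3 := Real.sqrt_pos.2 (by norm_num)
  have hs1 : 1 < √3 := by nlinarith
  have hs2 : √3 < 2 := by nlinarith
  -- Binet formula for the roots `2 ± √3`, whose difference is `2 * √3`. The first coefficient is at
  -- least `(√3 - 1) * u 0`, hence positive.
  have hu : ∀ n, u n * (2 * √3) =
      (u 1 - (2 - √3) * u 0) * (2 + √3) ^ n + ((2 + √3) * u 0 - u 1) * (2 - √3) ^ n := by
    intro n
    induction n using Nat.twoStepInduction with
    | zero => ring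
    | one => linear_combination 0 * hs
    | more n ih1 ih2 =>
      rw [h, sub_mul, mul_assoc, ih2, ih1]
      have e1 : (2 + √3) ^ (n + 2) = 4 * (2 + √3) ^ (n + 1) - (2 + √3) ^ n := by
        linear_combination (2 + √3) ^ n * hs
      have e2 : (2 - √3) ^ (n + 2) = 4 * (2 - √3) ^ (n + 1) - (2 - √3) ^ n := by
        linear_combination (2 - √3) ^ n * hs
      rw [e1, e2]; ring
  refine ⟨(u 1 - (2 - √3) * u 0) / (2 * √3), div_pos (by nlinarith) (by positivity), ?_⟩
  have hq : Tendsto (fun n : ℕ => ((2 - √3) / (2 + √3)) ^ n) atTop (nhds 0) := by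
    apply tendsto_pow_atTop_nhds_zero_of_lt_one
    · exact div_nonneg (by linarith) (by positivity)
    · rw [div_lt_one (by positivity)]; linarith
  have := (hq.const_mul (((2 + √3) * u 0 - u 1) / (2 * √3))).const_add
    ((u 1 - (2 - √3) * u 0) / (2 * √3))
  rw [mul_zero, add_zero] at this
  refine this.congr fun n => ?_
  have hn : u n = ((u 1 - (2 - √3) * u 0) * (2 + √3) ^ n +
      ((2 + √3) * u 0 - u 1) * (2 - √3) ^ n) / (2 * √3) := by
    rw [← hu]; field_simp
  rw [hn, div_pow]
  field_simp

theorem isEquivalent_mul_pow_of_tendsto {u : ℕ → ℝ} {b c : ℝ} (hc : 0 < c)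
    (h : Tendsto (fun n => u n / b ^ n) atTop (nhds c)) :
    u ~[atTop] fun n => c * b ^ n := by
  refine isEquivalent_of_tendsto_one ?_
  have := h.div_const c
  rw [div_self hc.ne'] at this
  refine this.congr fun n => ?_
  simp only [Pi.div_apply]
  rw [div_div, mul_comm]

theorem isEquivalent_succ_of_tendsto {u : ℕ → ℝ} {b c : ℝ} (hc : 0 < c)
    (h : Tendsto (fun n => u n / b ^ n) atTop (nhds c)) :
    (fun n => u (n + 1)) ~[atTop] fun n => b * u n := by
  have h1 := isEquivalent_mul_pow_of_tendsto hc h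
  have h2 : (fun n => u (n + 1)) ~[atTop] fun n => c * b ^ (n + 1) :=
    h1.comp_tendsto (tendsto_add_atTop_nat 1)
  have h3 : (fun n => b * u n) ~[atTop] fun n => b * (c * b ^ n) :=
    IsEquivalent.refl.mul h1
  refine h2.trans (h3.symm.congr_left ?_)
  exact Eventually.of_forall fun n => by ring

/-- The constant `a` absorbs the inhomogeneous term that the recurrence has for open paths; it
disappears after division by the growing power. -/
theorem asymptotics_of_recurrence {l : ℕ → ℕ} {a : ℝ}
    (h : ∀ n, (l (n + 2) : ℝ) - a = 4 * ((l (n + 1) : ℝ) - a) - ((l n : ℝ) - a))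
    (h0 : 0 < (l 0 : ℝ) - a) (h1 : l 0 ≤ l 1) :
    ∃ c : ℝ, 0 < c ∧ Tendsto (fun n => (l n : ℝ) / (2 + √3) ^ n) atTop (nhds c) := by
  obtain ⟨c, hc, ht⟩ := exists_tendsto_div_pow_of_recurrence (u := fun n => (l n : ℝ) - a) h h0
    (sub_le_sub_right (by exact_mod_cast h1) _)
  refine ⟨c, hc, ?_⟩
  have hz : Tendsto (fun n : ℕ => a / (2 + √3) ^ n) atTop (nhds 0) :=
    Tendsto.const_div_atTop (tendsto_pow_atTop_atTop_of_one_lt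
      (by linarith [Real.sqrt_nonneg 3])) a
  have := ht.add hz
  rw [add_zero] at this
  exact this.congr fun n => by rw [← add_div, sub_add_cancel]

/-- The ratio is a quotient of two terms of the single convergent sequence `s n / b ^ n`; both limit
statements about spheres rest on this. The integer exponent also covers `r < k`. -/
theorem div_zpow_sub_mul_eq {s : ℕ → ℝ} {b : ℝ} (hb : 0 < b) (k r : ℕ) :
    s r / (b ^ ((r : ℤ) - (k : ℤ)) * s k) = (s r / b ^ r) / (s k / b ^ k) := by
  rw [zpow_sub₀ hb.ne', zpow_natCast, zpow_natCast, div_mul_eq_mul_div, div_div_eq_mul_div,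
    div_div_div_eq]

theorem tendsto_div_zpow_sub_mul {s : ℕ → ℝ} {b c : ℝ} (hb : 0 < b)
    (h : Tendsto (fun n => s n / b ^ n) atTop (nhds c)) (k : ℕ) :
    Tendsto (fun r : ℕ => s r / (b ^ ((r : ℤ) - (k : ℤ)) * s k)) atTop
      (nhds (c / (s k / b ^ k))) :=
  (h.div_const (s k / b ^ k)).congr fun r => (div_zpow_sub_mul_eq hb k r).symm

/-- Uniformity comes from letting both indices tend to infinity independently: on the product filter
the quotient tends to `c / c = 1`. -/
theorem eventually_abs_div_zpow_sub_mul_lt {s : ℕ → ℝ} {b c : ℝ} (hb : 0 < b) (hc : 0 < c)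
    (h : Tendsto (fun n => s n / b ^ n) atTop (nhds c)) {ε : ℝ} (hε : 0 < ε) :
    ∃ K : ℕ, ∀ k r : ℕ, K ≤ k → k ≤ r →
      |s r / (b ^ ((r : ℤ) - (k : ℤ)) * s k) - 1| < ε := by
  have h2 : Tendsto (fun p : ℕ × ℕ => (s p.1 / b ^ p.1) / (s p.2 / b ^ p.2))
      (atTop ×ˢ atTop) (nhds (c / c)) :=
    (h.comp tendsto_fst).div (h.comp tendsto_snd) hc.ne'
  rw [div_self hc.ne', prod_atTop_atTop_eq, Metric.tendsto_atTop] at h2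
  obtain ⟨⟨N, M⟩, hN⟩ := h2 ε hε
  refine ⟨max N M, fun k r hk hr => ?_⟩
  have := hN (r, k) ⟨(le_max_left _ _).trans (hk.trans hr), (le_max_right _ _).trans hk⟩
  rw [Real.dist_eq] at this
  rwa [div_zpow_sub_mul_eq hb]

/-! ### Corners, fans of triangles, and the length recurrence of the shift -/

namespace BWLattice

variable {D : Type*} (L : BWLattice 8 D)

theorem rot_iterate_eight (d : D) : L.rot^[8] d = d := by
  have := Function.isPeriodicPt_minimalPeriod L.rot d
  rwa [L.degree d] at this

/-- This is the relation `(rot⁻¹ * rev) ^ 3 = 1` in solved form, the only way in which triangles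
enter the local computations. -/
theorem rev_rot_symm_rev (d : D) : L.rev (L.rot.symm (L.rev d)) = L.rot (L.rev (L.rot d)) := by
  have := Function.isPeriodicPt_minimalPeriod (fun e => L.rot.symm (L.rev e)) (L.rev (L.rot d))
  rw [L.three_sides] at this
  have h : L.rot.symm (L.rev (L.rot.symm (L.rev (L.rot.symm (L.rev (L.rev (L.rot d))))))) =
    L.rev (L.rot d) := this
  rw [L.rev_rev, Equiv.symm_apply_apply] at h
  rw [← h, Equiv.apply_symm_apply]

theorem rev_rot_rev (d : D) : L.rev (L.rot (L.rev d)) = L.rot.symm (L.rev (L.rot.symm d)) := by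
  have := L.rev_rot_symm_rev (L.rot.symm d)
  rw [Equiv.apply_symm_apply] at this
  rw [← this, L.rev_rev]

theorem rev_next (d : D) : L.rev (L.next d) = L.rot (L.rev (L.rot d)) := L.rev_rot_symm_rev d

theorem rot_iterate_injOn (d : D) : Set.InjOn (fun k => L.rot^[k] d) (Set.Iio 8) := by
  have := Function.iterate_injOn_Iio_minimalPeriod (f := L.rot) (x := d)
  rwa [L.degree d] at this

theorem sector_iterate (d : D) {k : ℕ} (hk : k < 8) :
    L.sector d (L.rot^[k] d) = List.iterate L.rot d k := by
  classical
  obtain ⟨n, hn⟩ : ∃ n, 8 = k + (n + 1) := ⟨7 - k, by omega⟩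
  have h : List.iterate L.rot d 8 = List.iterate L.rot d k ++
      (L.rot^[k] d :: List.iterate L.rot (L.rot (L.rot^[k] d)) n) := by
    rw [show List.iterate L.rot d 8 = List.iterate L.rot d (k + (n + 1)) from hn ▸ rfl,
      List.iterate_add]; rfl
  rw [sector, h, List.takeWhile_append_of_pos]
  · simp
  · intro e he
    obtain ⟨i, hi, rfl⟩ := List.mem_iterate.1 he
    simp only [ne_eq, decide_not, Bool.not_eq_eq_eq_not, Bool.not_true, decide_eq_false_iff_not]
    intro hik
    exact hi.ne (L.rot_iterate_injOn d (hi.trans hk) hk hik)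

theorem length_sector_eq {d e : D} {k : ℕ} (hk : k < 8) :
    (L.sector d e).length = k ↔ e = L.rot^[k] d := by
  classical
  constructor
  · intro h
    by_cases he : ∃ i < 8, e = L.rot^[i] d
    · obtain ⟨i, hi, rfl⟩ := he
      rw [L.sector_iterate d hi, List.length_iterate] at h
      rw [h]
    -- If `e` does not start at the origin of `d`, the sweep never stops and has length 8, which `k
    -- < 8` excludes.
    · have : L.sector d e = List.iterate L.rot d 8 := by
        rw [sector, List.takeWhile_eq_self_iff]
        intro x hx
        obtain ⟨i, hi, rfl⟩ := List.mem_iterate.1 hx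
        simp only [ne_eq, decide_not, Bool.not_eq_eq_eq_not, Bool.not_true,
          decide_eq_false_iff_not]
        exact fun h => he ⟨i, hi, h.symm⟩
      rw [this, List.length_iterate] at h
      omega
  · rintro rfl
    rw [L.sector_iterate d hk, List.length_iterate]

/-- A sector of length less than 8 already forces the two edges to join, so the incidence condition
is redundant. -/
theorem convexCorner_iff {d e : D} :
    L.ConvexCorner (d, e) ↔ e = L.rot^[2] (L.rev d) ∨ e = L.rot^[3] (L.rev d) := by
  simp only [ConvexCorner, rightTriangles]
  rw [L.length_sector_eq (by norm_num), L.length_sector_eq (by norm_num), and_iff_right_iff_imp]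
  rintro (rfl | rfl)
  · exact (L.origin_rot _).symm ▸ (L.origin_rot _).symm
  · simp only [Function.iterate_succ, Function.iterate_zero, Function.comp, id, L.origin_rot]
    rfl

/-- The side opposite to the origin of `e` in the triangle between `rot^[j - 1] e` and
`rot^[j] e`, with this triangle on its right. -/
def side (e : D) (j : ℕ) : D := L.rot (L.rev (L.rot^[j] e))

theorem rev_side_succ (e : D) (j : ℕ) :
    L.rev (L.side e (j + 1)) = L.rot.symm (L.rev (L.rot^[j] e)) := by
  rw [side, rev_rot_rev, Function.iterate_succ_apply', Equiv.symm_apply_apply]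

/-- Between these two sides only the edge back to the origin of `e` is swept: two triangles on the
right. -/
theorem side_eq_rot (e : D) (j : ℕ) : L.side e j = L.rot^[2] (L.rev (L.side e (j + 1))) := by
  rw [rev_side_succ, Function.iterate_succ_apply', Function.iterate_one, Equiv.apply_symm_apply,
    side]

theorem rot_side_eq_rot (e : D) (j : ℕ) :
    L.rot (L.side e j) = L.rot^[3] (L.rev (L.side e (j + 1))) := by
  rw [side_eq_rot]; rfl

/-- Both darts start at the apex of the triangle on the left of `e`, where the fan at the origin of
`e` meets the fan at the origin of `f`. The identity expresses the first edge of the second fan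
through `e`, so that its turn from `side e 2`, the last edge of the first fan, does not depend on
the corner at `f`. -/
theorem side_of_turn {e f : D} {j k : ℕ} (h : f = L.rot^[k] (L.rev e)) (hj : j + k = 7) :
    L.side f j = L.rot (L.side e 1) := by
  have h7 : L.rot^[7] (L.rev e) = L.rot.symm (L.rev e) := by
    rw [Equiv.eq_symm_apply, ← Function.iterate_succ_apply' L.rot 7, rot_iterate_eight]
  rw [side, h, ← Function.iterate_add_apply, hj, h7, rev_rot_symm_rev]; rfl

theorem leftTriangles_of_turn {d e : D} {j k : ℕ} (h : e = L.rot^[k] (L.rev d)) (hj : j + k = 8)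
    (hk : 0 < k) : L.leftTriangles d e = List.iterate L.rot e j := by
  have : L.rev d = L.rot^[j] e := by
    rw [h, ← Function.iterate_add_apply, hj, rot_iterate_eight]
  rw [leftTriangles, this, L.sector_iterate _ (by omega)]

theorem shiftCorner_of_turn_two {d e : D} (h : e = L.rot^[2] (L.rev d)) :
    L.shiftCorner (d, e) = [L.side e 5, L.side e 4, L.side e 3, L.side e 2] := by
  simp [shiftCorner, L.leftTriangles_of_turn h (j := 6), List.iterate, rev_next, side]

theorem shiftCorner_of_turn_three {d e : D} (h : e = L.rot^[3] (L.rev d)) :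
    L.shiftCorner (d, e) = [L.side e 4, L.side e 3, L.side e 2] := by
  simp [shiftCorner, L.leftTriangles_of_turn h (j := 5), List.iterate, rev_next, side]

theorem shiftOpen_cons_cons (d e : D) (l : List D) :
    L.shiftOpen (d :: e :: l) = L.shiftCorner (d, e) ++ L.shiftOpen (e :: l) := rfl

theorem shiftOpen_singleton (d : D) : L.shiftOpen [d] = [] := rfl

theorem forall_mem_corners {P : D × D → Prop} (l : List D) :
    (∀ c ∈ corners l, P c) ↔ l.IsChain fun d e => P (d, e) := by
  induction l with
  | nil => simp [corners]
  | cons d l ih =>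
    cases l with
    | nil => simp [corners]
    | cons e l =>
      rw [List.isChain_cons_cons, ← ih]
      simp [corners]

theorem length_shiftCorner_side (e : D) (j : ℕ) :
    (L.shiftCorner (L.side e (j + 1), L.side e j)).length = 4 := by
  rw [L.shiftCorner_of_turn_two (L.side_eq_rot e j)]; rfl

theorem length_shiftCorner_rot_side (e : D) (j : ℕ) :
    (L.shiftCorner (L.side e (j + 1), L.rot (L.side e j))).length = 3 := by
  rw [L.shiftCorner_of_turn_three (L.rot_side_eq_rot e j)]; rfl

theorem convexCorner_side (e : D) (j : ℕ) : L.ConvexCorner (L.side e (j + 1), L.side e j) :=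
  L.convexCorner_iff.2 (.inl (L.side_eq_rot e j))

theorem convexCorner_rot_side (e : D) (j : ℕ) :
    L.ConvexCorner (L.side e (j + 1), L.rot (L.side e j)) :=
  L.convexCorner_iff.2 (.inr (L.rot_side_eq_rot e j))

/-- The first and last edges of the shift depend only on the first and last edges of the path. This
glues fans in the induction, each junction being a corner with three triangles on the right, and
later closes up cyclic paths. There are `l.length` junctions and all other corners yield four edges,
whence the length identity. -/
theorem shiftOpen_of_isChain {d e : D} {l : List D}
    (h : (d :: e :: l).IsChain fun d e => L.ConvexCorner (d, e)) :
    ∃ p q, L.shiftOpen (d :: e :: l) = L.rot (L.side d 1) :: p ∧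
      L.shiftOpen (d :: e :: l) = q ++ [L.side ((e :: l).getLast (by simp)) 2] ∧
      (L.shiftOpen (d :: e :: l)).IsChain (fun d e => L.ConvexCorner (d, e)) ∧
      3 * (l.length + 1) ≤ (L.shiftOpen (d :: e :: l)).length ∧
      (L.shiftOpen (L.shiftOpen (d :: e :: l))).length + (l.length + 4) =
        4 * (L.shiftOpen (d :: e :: l)).length := by
  induction l generalizing d e with
  | nil =>
    rw [List.isChain_pair, convexCorner_iff] at h
    rcases h with h | h
    · have hs := L.side_of_turn (j := 5) h rfl
      refine ⟨[L.side e 4, L.side e 3, L.side e 2], [L.side e 5, L.side e 4, L.side e 3], ?_⟩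
      simp [shiftOpen_cons_cons, shiftOpen_singleton, shiftCorner_of_turn_two _ h, hs,
        length_shiftCorner_side, convexCorner_side]
      simp [← hs, length_shiftCorner_side, convexCorner_side]
    · have hs := L.side_of_turn (j := 4) h rfl
      refine ⟨[L.side e 3, L.side e 2], [L.side e 4, L.side e 3], ?_⟩
      simp [shiftOpen_cons_cons, shiftOpen_singleton, shiftCorner_of_turn_three _ h, hs,
        length_shiftCorner_side, convexCorner_side]
      simp [← hs, length_shiftCorner_side, convexCorner_side]
  | cons f l ih =>
    rw [List.isChain_cons_cons, convexCorner_iff] at h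
    obtain ⟨p, q, hp, hq, hc, hl, ht⟩ := ih h.2
    rw [shiftOpen_cons_cons]
    rcases h.1 with h | h
    · have hs := L.side_of_turn (j := 5) h rfl
      refine ⟨[L.side e 4, L.side e 3, L.side e 2] ++ L.shiftOpen (e :: f :: l),
        [L.side e 5, L.side e 4, L.side e 3, L.side e 2] ++ q, ?_, ?_, ?_, ?_, ?_⟩
      · simp [shiftCorner_of_turn_two _ h, hs]
      · simp [shiftCorner_of_turn_two _ h, hq]
      · rw [hp] at hc ⊢
        simp [shiftCorner_of_turn_two _ h, hc, convexCorner_side, convexCorner_rot_side]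
      · simp [shiftCorner_of_turn_two _ h] at hl ⊢
        omega
      · rw [hp] at ht ⊢
        simp [shiftCorner_of_turn_two _ h, shiftOpen_cons_cons, length_shiftCorner_side,
          length_shiftCorner_rot_side] at ht ⊢
        omega
    · have hs := L.side_of_turn (j := 4) h rfl
      refine ⟨[L.side e 3, L.side e 2] ++ L.shiftOpen (e :: f :: l),
        [L.side e 4, L.side e 3, L.side e 2] ++ q, ?_, ?_, ?_, ?_, ?_⟩
      · simp [shiftCorner_of_turn_three _ h, hs]
      · simp [shiftCorner_of_turn_three _ h, hq]
      · rw [hp] at hc ⊢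
        simp [shiftCorner_of_turn_three _ h, hc, convexCorner_side, convexCorner_rot_side]
      · simp [shiftCorner_of_turn_three _ h] at hl ⊢
        omega
      · rw [hp] at ht ⊢
        simp [shiftCorner_of_turn_three _ h, shiftOpen_cons_cons, length_shiftCorner_side,
          length_shiftCorner_rot_side] at ht ⊢
        omega

theorem isRightConvexOpen_iff {γ : List D} : L.IsRightConvexOpen γ ↔
    2 ≤ γ.length ∧ γ.IsChain fun d e => L.ConvexCorner (d, e) := by
  rw [IsRightConvexOpen, forall_mem_corners]

theorem IsRightConvexOpen.shift {γ : List D} (h : L.IsRightConvexOpen γ) :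
    L.IsRightConvexOpen (L.shiftOpen γ) ∧ γ.length ≤ (L.shiftOpen γ).length ∧
      (L.shiftOpen (L.shiftOpen γ)).length + (γ.length + 2) =
        4 * (L.shiftOpen γ).length := by
  rw [isRightConvexOpen_iff] at h ⊢
  match γ, h with
  | d :: e :: l, h =>
    obtain ⟨p, q, -, -, hc, hl, ht⟩ := L.shiftOpen_of_isChain h.2
    simp only [List.length_cons] at *
    exact ⟨⟨by omega, hc⟩, by omega, by omega⟩

theorem cyclicCorners_cons (d : D) (l : List D) :
    cyclicCorners (d :: l) = corners (d :: l ++ [d]) := by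
  have := List.zip_append (l₁ := d :: l) (r₁ := [d]) (l₂ := l ++ [d]) (r₂ := []) (by simp)
  simpa [cyclicCorners, corners] using this.symm

theorem isRightConvexClosed_cons_iff {d : D} {l : List D} : L.IsRightConvexClosed (d :: l) ↔
    (d :: l ++ [d]).IsChain fun d e => L.ConvexCorner (d, e) := by
  rw [IsRightConvexClosed, cyclicCorners_cons, forall_mem_corners]
  simp

theorem shiftClosed_cons (d : D) (l : List D) :
    L.shiftClosed (d :: l) = L.shiftOpen (d :: l ++ [d]) := by
  rw [shiftClosed, cyclicCorners_cons, shiftOpen]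

theorem IsRightConvexClosed.shift {γ : List D} (h : L.IsRightConvexClosed γ) :
    L.IsRightConvexClosed (L.shiftClosed γ) ∧ γ.length ≤ (L.shiftClosed γ).length ∧
      (L.shiftClosed (L.shiftClosed γ)).length + γ.length = 4 * (L.shiftClosed γ).length := by
  match γ, h with
  | [], h => exact absurd rfl h.1
  | d :: l, h =>
    rw [isRightConvexClosed_cons_iff] at h
    rw [shiftClosed_cons]
    obtain ⟨e, l', hl'⟩ : ∃ e l', l ++ [d] = e :: l' := List.exists_cons_of_ne_nil (by simp)
    have hlast : (e :: l').getLast (by simp) = d := by simp [← hl']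
    have hlen : l.length = l'.length := by simpa using congrArg List.length hl'
    rw [List.cons_append, hl'] at h ⊢
    obtain ⟨p, q, hp, hq, hc, hl, ht⟩ := L.shiftOpen_of_isChain h
    rw [hlast] at hq
    -- Appending an edge adds just the fan of the new last corner.
    have happ : ∀ f, L.shiftOpen (q ++ [L.side d 2] ++ [f]) =
        L.shiftOpen (q ++ [L.side d 2]) ++ L.shiftCorner (L.side d 2, f) := by
      intro f
      clear hq
      induction q with
      | nil => simp [shiftOpen_cons_cons, shiftOpen_singleton]
      | cons x q ih =>
        cases q with
        | nil => simp [shiftOpen_cons_cons, shiftOpen_singleton]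
        | cons y q =>
          simp only [List.cons_append, shiftOpen_cons_cons, List.append_assoc] at ih ⊢
          rw [ih]
    have hcc : L.shiftOpen (d :: e :: l') ++ [L.rot (L.side d 1)] =
        q ++ [L.side d 2] ++ [L.rot (L.side d 1)] := by rw [hq]
    -- The closed path is opened by repeating its first edge `d`. Compared with the open case, the
    -- second shift gains one wrap-around corner, which contributes three edges and cancels the
    -- inhomogeneous term.
    have hsc : L.shiftClosed (L.shiftOpen (d :: e :: l')) =
        L.shiftOpen (L.shiftOpen (d :: e :: l')) ++
          L.shiftCorner (L.side d 2, L.rot (L.side d 1)) := by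
      conv_lhs => rw [hp, shiftClosed_cons, ← hp, hcc, happ, ← hq]
    refine ⟨?_, ?_, ?_⟩
    · rw [hp, isRightConvexClosed_cons_iff, ← hp, List.isChain_append]
      refine ⟨hc, by simp, ?_⟩
      rw [hq]
      simp [convexCorner_rot_side]
    · simp only [List.length_cons]; omega
    · rw [hsc, List.length_append, length_shiftCorner_rot_side, List.length_cons]
      omega

theorem isRightConvexOpen_iterate {γ : List D} (h : L.IsRightConvexOpen γ) (n : ℕ) :
    L.IsRightConvexOpen (L.shiftOpen^[n] γ) := by
  induction n with
  | zero => exact h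
  | succ n ih => rw [Function.iterate_succ_apply']; exact ih.shift.1

theorem isRightConvexClosed_iterate {γ : List D} (h : L.IsRightConvexClosed γ) (n : ℕ) :
    L.IsRightConvexClosed (L.shiftClosed^[n] γ) := by
  induction n with
  | zero => exact h
  | succ n ih => rw [Function.iterate_succ_apply']; exact ih.shift.1

theorem tendsto_length_shiftOpen {γ : List D} (h : L.IsRightConvexOpen γ) :
    ∃ c : ℝ, 0 < c ∧
      Tendsto (fun n => ((L.shiftOpen^[n] γ).length : ℝ) / (2 + √3) ^ n) atTop (nhds c) := by
  -- The value 1 is the fixed point of `l'' + l + 2 = 4 * l'`; a path with at least two edges lies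
  -- above it.
  refine asymptotics_of_recurrence (l := fun n => (L.shiftOpen^[n] γ).length) (a := 1)
    (fun n => ?_) ?_ h.shift.2.1
  · have := congrArg (Nat.cast (R := ℝ)) (L.isRightConvexOpen_iterate h n).shift.2.2
    rw [← Function.iterate_succ_apply' L.shiftOpen, ← Function.iterate_succ_apply' L.shiftOpen]
      at this
    push_cast at this
    linarith
  · have : (2 : ℝ) ≤ γ.length := by exact_mod_cast h.1
    simp only [Function.iterate_zero, id]
    linarith

theorem tendsto_length_shiftClosed {γ : List D} (h : L.IsRightConvexClosed γ) :
    ∃ c : ℝ, 0 < c ∧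
      Tendsto (fun n => ((L.shiftClosed^[n] γ).length : ℝ) / (2 + √3) ^ n) atTop (nhds c) := by
  refine asymptotics_of_recurrence (l := fun n => (L.shiftClosed^[n] γ).length) (a := 0)
    (fun n => ?_) ?_ h.shift.2.1
  · have := congrArg (Nat.cast (R := ℝ)) (L.isRightConvexClosed_iterate h n).shift.2.2
    rw [← Function.iterate_succ_apply' L.shiftClosed, ← Function.iterate_succ_apply' L.shiftClosed]
      at this
    push_cast at this
    linarith
  · simpa [List.length_pos_iff] using h.1

end BWLattice

/-! ### The ball model: circles, reversal of darts, triangles -/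

/-- The vertices other than the center of the ball model of the lattice. The Boolean says whether
the vertex has two neighbors that are nearer to the center, or only one. The vertices around the
center are `base i`, and the vertices that a vertex `w` sees outside are, clockwise, `first w`,
`second w`, `third w`, `fourth w` (which exists if `w` has only one neighbor inside), and `first`
of the successor of `w` on its circle. -/
inductive Node : Bool → Type
  | base (i : Fin 8) : Node false
  | first {b : Bool} (w : Node b) : Node true
  | second {b : Bool} (w : Node b) : Node false
  | third {b : Bool} (w : Node b) : Node false
  | fourth (w : Node false) : Node false

namespace Node

/-- The last of the vertices that are attached to `w`. -/
def last : (b : Bool) → Node b → Sigma Node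
  | true, w => ⟨_, third w⟩
  | false, w => ⟨_, fourth w⟩

/-- The next vertex in clockwise order on the circle around the center. -/
def succ : {b : Bool} → Node b → Sigma Node
  | _, base i => ⟨_, base (i - 1)⟩
  | _, first w => ⟨_, second w⟩
  | _, second w => ⟨_, third w⟩
  | _, @third true w => ⟨_, first (succ w).2⟩
  | _, @third false w => ⟨_, fourth w⟩
  | _, fourth w => ⟨_, first (succ w).2⟩

/-- The next vertex in counterclockwise order on the circle around the center. -/
def pred : {b : Bool} → Node b → Sigma Node
  | _, base i => ⟨_, base (i + 1)⟩
  | _, first w => last _ (pred w).2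
  | _, second w => ⟨_, first w⟩
  | _, third w => ⟨_, second w⟩
  | _, fourth w => ⟨_, third w⟩

/-- Only the passage from the last child of one vertex to the first child of the next needs the
induction hypothesis. -/
theorem pred_succ {b : Bool} (w : Node b) : pred (succ w).2 = ⟨b, w⟩ := by
  induction w with
  | base i => simp [succ, pred]
  | first w ih => rfl
  | second w ih => rfl
  | @third b w ih =>
    cases b
    · rfl
    · change last _ (pred (succ w).2).2 = _
      rw [ih]; rfl
  | fourth w ih =>
    change last _ (pred (succ w).2).2 = _
    rw [ih]; rfl

theorem succ_pred {b : Bool} (w : Node b) : succ (pred w).2 = ⟨b, w⟩ := by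
  induction w with
  | base i => simp [succ, pred]
  | @first b w ih =>
    rw [pred]
    rcases h : pred w with ⟨c, v⟩
    rw [h] at ih
    replace ih : succ v = ⟨b, w⟩ := ih
    cases c
    · change (⟨_, first (succ v).2⟩ : Sigma Node) = _
      rw [ih]
    · change (⟨_, first (succ v).2⟩ : Sigma Node) = _
      rw [ih]
  | second w ih => rfl
  | @third b w ih => rfl
  | fourth w ih => rfl

/-- The vertices attached to `w`. -/
def children : (b : Bool) → Node b → List (Sigma Node)
  | true, w => [⟨_, first w⟩, ⟨_, second w⟩, ⟨_, third w⟩]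
  | false, w => [⟨_, first w⟩, ⟨_, second w⟩, ⟨_, third w⟩, ⟨_, fourth w⟩]

/-- The distance to the circle of the vertices `base i`. -/
def level : {b : Bool} → Node b → ℕ
  | _, base _ => 0
  | _, first w => level w + 1
  | _, second w => level w + 1
  | _, third w => level w + 1
  | _, fourth w => level w + 1

theorem level_succ {b : Bool} (w : Node b) : level (succ w).2 = level w := by
  induction w with
  | @third b w ih => cases b <;> simp [succ, level, ih]
  | _ => simp [succ, level, *]

theorem level_pred {b : Bool} (w : Node b) : level (pred w).2 = level w := by
  rw [← level_succ, succ_pred]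

/-- The number of the dart at `w` that leads to its predecessor. -/
def back : Bool → Fin 8
  | true => 5
  | false => 6

/-- The dart to `w` from the vertex that `w` is attached to. -/
def parent : {b : Bool} → Node b → Option (Sigma Node) × Fin 8
  | _, base i => (none, i)
  | _, @first true w => (some ⟨_, w⟩, 4)
  | _, @first false w => (some ⟨_, w⟩, 5)
  | _, @second true w => (some ⟨_, w⟩, 3)
  | _, @second false w => (some ⟨_, w⟩, 4)
  | _, @third true w => (some ⟨_, w⟩, 2)
  | _, @third false w => (some ⟨_, w⟩, 3)
  | _, fourth w => (some ⟨_, w⟩, 2)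

/-- The reversal of the darts of the ball model. The darts at a vertex are numbered in
counterclockwise order, for a vertex other than the center beginning with the dart to the successor,
and such that number `7` is the dart to the vertex it is attached to. -/
def flip : Option (Sigma Node) × Fin 8 → Option (Sigma Node) × Fin 8
  | (none, i) => (some ⟨_, base i⟩, 7)
  | (some ⟨_, w⟩, 0) => (some (succ w), back (succ w).1)
  | (some ⟨_, w⟩, 1) => (some ⟨_, first (succ w).2⟩, 6)
  | (some ⟨true, w⟩, 2) => (some ⟨_, third w⟩, 7)
  | (some ⟨true, w⟩, 3) => (some ⟨_, second w⟩, 7)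
  | (some ⟨true, w⟩, 4) => (some ⟨_, first w⟩, 7)
  | (some ⟨true, w⟩, 5) => (some (pred w), 0)
  | (some ⟨true, first w⟩, 6) => (some (pred w), 1)
  | (some ⟨false, w⟩, 2) => (some ⟨_, fourth w⟩, 7)
  | (some ⟨false, w⟩, 3) => (some ⟨_, third w⟩, 7)
  | (some ⟨false, w⟩, 4) => (some ⟨_, second w⟩, 7)
  | (some ⟨false, w⟩, 5) => (some ⟨_, first w⟩, 7)
  | (some ⟨false, w⟩, 6) => (some (pred w), 0)
  | (some ⟨_, w⟩, 7) => parent w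

theorem flip_zero (s : Sigma Node) : flip (some s, 0) = (some (succ s.2), back (succ s.2).1) := by
  obtain ⟨b, w⟩ := s; cases b <;> rfl

theorem flip_one (s : Sigma Node) : flip (some s, 1) = (some ⟨_, first (succ s.2).2⟩, 6) := by
  obtain ⟨b, w⟩ := s; cases b <;> rfl

theorem flip_seven (s : Sigma Node) : flip (some s, 7) = parent s.2 := by
  obtain ⟨b, w⟩ := s
  cases b
  · rfl
  · cases w; rfl

theorem flip_back (s : Sigma Node) : flip (some s, back s.1) = (some (pred s.2), 0) := by
  obtain ⟨b, w⟩ := s; cases b <;> rfl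

theorem flip_parent {b : Bool} (w : Node b) : flip (parent w) = (some ⟨_, w⟩, 7) := by
  cases w with
  | base i => rfl
  | @first b w => cases b <;> rfl
  | @second b w => cases b <;> rfl
  | @third b w => cases b <;> rfl
  | fourth w => rfl

theorem flip_flip (x : Option (Sigma Node) × Fin 8) : flip (flip x) = x := by
  have h0 : ∀ s : Sigma Node, flip (flip (some s, 0)) = (some s, 0) := fun s => by
    rw [flip_zero, flip_back, pred_succ]
  have h1 : ∀ s : Sigma Node, flip (flip (some s, 1)) = (some s, 1) := fun s => by
    rw [flip_one, flip, pred_succ]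
  have h7 : ∀ s : Sigma Node, flip (flip (some s, 7)) = (some s, 7) := fun s => by
    rw [flip_seven, flip_parent]
  obtain ⟨_ | s, j⟩ := x
  · rfl
  have hb : flip (flip (some s, back s.1)) = (some s, back s.1) := by
    rw [flip_back, flip_zero, succ_pred]
  obtain ⟨b, w⟩ := s
  cases b
  · fin_cases j
    exacts [h0 _, h1 _, rfl, rfl, rfl, rfl, hb, h7 _]
  · fin_cases j
    · exact h0 _
    · exact h1 _
    · rfl
    · rfl
    · rfl
    · exact hb
    -- Only vertices of the form `first w` have a second inner neighbor, namely `pred w`.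
    · cases w with
      | first w =>
        change flip (some (pred w), 1) = _
        rw [flip_one, succ_pred]; rfl
    · exact h7 _

/-- The number before `i` in cyclic order. -/
def dec : Fin 8 → Fin 8
  | 0 => 7
  | 1 => 0
  | 2 => 1
  | 3 => 2
  | 4 => 3
  | 5 => 4
  | 6 => 5
  | 7 => 6

/-- The next side of the triangle on the left, for the darts of the ball model. -/
def turn (x : Option (Sigma Node) × Fin 8) : Option (Sigma Node) × Fin 8 :=
  ((flip x).1, dec (flip x).2)

theorem turn_zero (s : Sigma Node) :
    turn (some s, 0) = (some (succ s.2), dec (back (succ s.2).1)) := by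
  rw [turn, flip_zero]

theorem turn_dec_back (s : Sigma Node) :
    turn (some s, dec (back s.1)) = (some ⟨_, first s.2⟩, 6) := by
  rcases s with ⟨_ | _, w⟩ <;> rfl

theorem turn_first_six {b : Bool} (w : Node b) :
    turn (some ⟨_, first w⟩, 6) = (some (pred w), 0) := by
  rw [turn, flip]; rfl

theorem turn_one (s : Sigma Node) :
    turn (some s, 1) = (some ⟨_, first (succ s.2).2⟩, 5) := by
  rw [turn, flip_one]; rfl

theorem turn_first_five {b : Bool} (w : Node b) :
    turn (some ⟨_, first w⟩, 5) = (some (last _ (pred w).2), 7) := rfl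

theorem turn_last_seven (s : Sigma Node) : turn (some (last _ s.2), 7) = (some s, 1) := by
  rcases s with ⟨_ | _, w⟩ <;> rfl

/-- Closing up of a triangle, once checked from one side, passes to its other sides. -/
theorem turn_pow_three_turn {x : Option (Sigma Node) × Fin 8}
    (h : turn (turn (turn x)) = x) : turn (turn (turn (turn x))) = turn x := congrArg turn h

theorem turn_pow_three_zero (s : Sigma Node) : turn (turn (turn (some s, 0))) = (some s, 0) := by
  rw [turn_zero, turn_dec_back, turn_first_six, pred_succ]

theorem turn_pow_three_dec_back (s : Sigma Node) :
    turn (turn (turn (some s, dec (back s.1)))) = (some s, dec (back s.1)) := by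
  rw [turn_dec_back, turn_first_six, turn_zero, succ_pred]

theorem turn_pow_three_one (s : Sigma Node) : turn (turn (turn (some s, 1))) = (some s, 1) := by
  rw [turn_one, turn_first_five, pred_succ, turn_last_seven]

theorem turn_pow_three_last_seven (s : Sigma Node) :
    turn (turn (turn (some (last _ s.2), 7))) = (some (last _ s.2), 7) := by
  rw [turn_last_seven, turn_one, turn_first_five, pred_succ]

theorem turn_pow_three_none (i : Fin 8) : turn (turn (turn (none, i))) = (none, i) := by
  change ((none, dec (i + 1)) : Option (Sigma Node) × Fin 8) = (none, i)
  rw [show dec (i + 1) = i by revert i; decide]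

theorem turn_pow_three (x : Option (Sigma Node) × Fin 8) : turn (turn (turn x)) = x := by
  obtain ⟨_ | ⟨b, w⟩, j⟩ := x
  · exact turn_pow_three_none j
  cases b
  · fin_cases j
    · exact turn_pow_three_zero _
    · exact turn_pow_three_one _
    · rfl
    · rfl
    · rfl
    · exact turn_pow_three_dec_back ⟨_, w⟩
    · cases w with
      | base i => exact turn_pow_three_turn (turn_pow_three_none i)
      | @second b w => cases b <;> rfl
      | @third b w => cases b <;> rfl
      | fourth w => rfl
    · cases w with
      | base i =>
        -- The dart from `base i` to the center is the third side of the central triangle that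
        -- starts with dart `i - 1`.
        have := turn_pow_three_turn (turn_pow_three_turn (turn_pow_three_none (i - 1)))
        change turn (turn (turn (some ⟨_, base (i - 1 + 1)⟩, 7))) = (some ⟨_, base (i - 1 + 1)⟩, 7)
          at this
        rwa [sub_add_cancel] at this
      | @second b w => cases b <;> rfl
      | @third b w =>
        cases b
        · rfl
        · exact turn_pow_three_last_seven ⟨true, w⟩
      | fourth w => exact turn_pow_three_last_seven ⟨false, w⟩
  · cases w with
    | @first b w =>
      fin_cases j
      · exact turn_pow_three_zero _
      · exact turn_pow_three_one _
      · rfl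
      · rfl
      · exact turn_pow_three_dec_back ⟨true, first w⟩
      · have := turn_pow_three_turn (turn_pow_three_one (pred w))
        rwa [turn_one, succ_pred] at this
      · have := turn_pow_three_turn (turn_pow_three_dec_back ⟨_, w⟩)
        rwa [turn_dec_back] at this
      · cases b <;> rfl

end Node

/-! ### The map from the ball model to the lattice -/

namespace BWLattice

variable {D : Type*} (L : BWLattice 8 D)

/-- The image in the lattice of the dart from `w` to its successor. -/
def place (o : D) : {b : Bool} → Node b → D
  | _, .base i => L.side o i
  | _, @Node.first true w => L.side (place o w) 4
  | _, @Node.first false w => L.side (place o w) 5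
  | _, @Node.second true w => L.side (place o w) 3
  | _, @Node.second false w => L.side (place o w) 4
  | _, @Node.third true w => L.side (place o w) 2
  | _, @Node.third false w => L.side (place o w) 3
  | _, .fourth w => L.side (place o w) 2

/-- The Boolean of a vertex records the corner of its circle there: one inner neighbor means two
triangles on the inner (right) side, two inner neighbors mean three. -/
theorem place_succ (o : D) {b : Bool} (w : Node b) :
    L.place o w.succ.2 = L.rot^[bif w.succ.1 then 3 else 2] (L.rev (L.place o w)) := by
  induction w with
  | base i =>
    have : ((i - 1 : Fin 8) : ℕ) + 1 = i ∨ i = 0 := by revert i; decide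
    rcases this with h | rfl
    · rw [Node.succ, place, place, ← h, L.side_eq_rot]; rfl
    · change L.side o 7 = L.rot^[2] (L.rev (L.side o 0))
      rw [side_eq_rot, side, side, rot_iterate_eight]; rfl
  | @first b w ih => cases b <;> exact L.side_eq_rot _ _
  | @second b w ih => cases b <;> exact L.side_eq_rot _ _
  | @third b w ih =>
    cases b
    · exact L.side_eq_rot _ _
    · rw [Node.succ]
      rcases h : w.succ with ⟨_ | _, v⟩ <;> rw [h] at ih
      · exact (L.side_of_turn ih rfl).trans (L.rot_side_eq_rot _ 1)
      · exact (L.side_of_turn ih rfl).trans (L.rot_side_eq_rot _ 1)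
  | fourth w ih =>
    rw [Node.succ]
    rcases h : w.succ with ⟨_ | _, v⟩ <;> rw [h] at ih
    · exact (L.side_of_turn ih rfl).trans (L.rot_side_eq_rot _ 1)
    · exact (L.side_of_turn ih rfl).trans (L.rot_side_eq_rot _ 1)

theorem place_first_succ (o : D) {b : Bool} (w : Node b) :
    L.place o (Node.first w.succ.2) = L.rot (L.side (L.place o w) 1) := by
  have := L.place_succ o w
  rcases h : w.succ with ⟨_ | _, v⟩ <;> rw [h] at this <;> exact L.side_of_turn this rfl

/-- The map from the darts of the ball model to the lattice. -/
def placeDart (o : D) : Option (Sigma Node) × Fin 8 → D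
  | (none, i) => L.rot^[i] o
  | (some s, i) => L.rot^[i] (L.place o s.2)

theorem placeDart_eq (o : D) (u : Option (Sigma Node)) (i : Fin 8) :
    L.placeDart o (u, i) = L.rot^[i] (L.placeDart o (u, 0)) := by
  cases u <;> rfl

/-- This matches the convention that dart 7 of a model vertex leads to the vertex it is attached to.
-/
theorem rot_iterate_seven_side (e : D) (j : ℕ) : L.rot^[7] (L.side e j) = L.rev (L.rot^[j] e) := by
  rw [side, ← Function.iterate_succ_apply, rot_iterate_eight]

theorem placeDart_parent (o : D) {b : Bool} (w : Node b) :
    L.placeDart o w.parent = L.rev (L.rot^[7] (L.place o w)) := by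
  rw [← L.rev_rev (L.placeDart o w.parent)]
  refine congrArg L.rev ?_
  cases w with
  | base i => exact (L.rot_iterate_seven_side _ _).symm
  | @first b w => cases b <;> exact (L.rot_iterate_seven_side _ _).symm
  | @second b w => cases b <;> exact (L.rot_iterate_seven_side _ _).symm
  | @third b w => cases b <;> exact (L.rot_iterate_seven_side _ _).symm
  | fourth w => exact (L.rot_iterate_seven_side _ _).symm

theorem placeDart_flip_zero (o : D) (s : Sigma Node) :
    L.placeDart o (Node.flip (some s, 0)) = L.rev (L.placeDart o (some s, 0)) := by
  have := L.place_succ o s.2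
  rw [Node.flip_zero]
  change _ = L.rev (L.place o s.2)
  rcases h : s.2.succ with ⟨_ | _, v⟩ <;> rw [h] at this <;>
    simp only [placeDart, this]
  · exact L.rot_iterate_eight _
  · exact L.rot_iterate_eight _

theorem placeDart_flip_one (o : D) (s : Sigma Node) :
    L.placeDart o (Node.flip (some s, 1)) = L.rev (L.placeDart o (some s, 1)) := by
  rw [Node.flip_one]
  change L.rot^[6] (L.place o (Node.first s.2.succ.2)) = L.rev (L.rot (L.place o s.2))
  rw [place_first_succ, ← Function.iterate_succ_apply, rot_iterate_seven_side]; rfl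

theorem placeDart_flip_of_flip {o : D} {x y : Option (Sigma Node) × Fin 8}
    (h : L.placeDart o (Node.flip y) = L.rev (L.placeDart o y)) (hx : Node.flip x = y) :
    L.placeDart o (Node.flip x) = L.rev (L.placeDart o x) := by
  subst hx
  rw [Node.flip_flip] at h
  rw [h, L.rev_rev]

/-- Since `flip` is an involution, it suffices to compute with one orientation of each edge: the
darts to the successor, to `first` of the successor, and to the parent. -/
theorem placeDart_flip (o : D) (x : Option (Sigma Node) × Fin 8) :
    L.placeDart o (Node.flip x) = L.rev (L.placeDart o x) := by
  have h7 : ∀ s : Sigma Node,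
      L.placeDart o (Node.flip (some s, 7)) = L.rev (L.placeDart o (some s, 7)) := fun s => by
    rw [Node.flip_seven]; exact L.placeDart_parent o s.2
  obtain ⟨_ | s, j⟩ := x
  · exact L.placeDart_flip_of_flip (h7 _) rfl
  obtain ⟨b, w⟩ := s
  cases b
  · fin_cases j
    · exact L.placeDart_flip_zero o _
    · exact L.placeDart_flip_one o _
    · exact L.placeDart_flip_of_flip (h7 _) rfl
    · exact L.placeDart_flip_of_flip (h7 _) rfl
    · exact L.placeDart_flip_of_flip (h7 _) rfl
    · exact L.placeDart_flip_of_flip (h7 _) rfl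
    · exact L.placeDart_flip_of_flip (L.placeDart_flip_zero o _) rfl
    · exact h7 _
  · fin_cases j
    · exact L.placeDart_flip_zero o _
    · exact L.placeDart_flip_one o _
    · exact L.placeDart_flip_of_flip (h7 _) rfl
    · exact L.placeDart_flip_of_flip (h7 _) rfl
    · exact L.placeDart_flip_of_flip (h7 _) rfl
    · exact L.placeDart_flip_of_flip (L.placeDart_flip_zero o _) rfl
    · cases w with
      | first w => exact L.placeDart_flip_of_flip (L.placeDart_flip_one o _) rfl
    · exact h7 _

end BWLattice

/-! ### Lifting of paths, bijectivity on vertices, and distances -/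

namespace TriangulatedSurface

theorem isPath_append_iff {D : Type*} (M : TriangulatedSurface D) {v w : M.Vertex}
    {p q : List D} : M.IsPath v w (p ++ q) ↔ ∃ x, M.IsPath v x p ∧ M.IsPath x w q := by
  induction p generalizing v with
  | nil => simp [IsPath]
  | cons d p ih => simp [IsPath, ih, and_assoc]

end TriangulatedSurface

namespace Node

/-- The distance to the center of the ball model. -/
def radius : Option (Sigma Node) → ℕ
  | none => 0
  | some s => level s.2 + 1

theorem radius_parent {b : Bool} (w : Node b) : radius (parent w).1 = level w := by
  cases w with
  | base i => rfl
  | @first b w => cases b <;> rfl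
  | @second b w => cases b <;> rfl
  | @third b w => cases b <;> rfl
  | fourth w => rfl

theorem radius_flip_le (x : Option (Sigma Node) × Fin 8) :
    radius (flip x).1 ≤ radius x.1 + 1 := by
  have h0 : ∀ s : Sigma Node, radius (flip (some s, 0)).1 ≤ radius (some s) + 1 := fun s => by
    rw [flip_zero]; simp [radius, level_succ]
  have h1 : ∀ s : Sigma Node, radius (flip (some s, 1)).1 ≤ radius (some s) + 1 := fun s => by
    rw [flip_one]; simp [radius, level, level_succ]
  have hb : ∀ s : Sigma Node, radius (flip (some s, back s.1)).1 ≤ radius (some s) + 1 :=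
    fun s => by rw [flip_back]; simp [radius, level_pred]
  have h7 : ∀ s : Sigma Node, radius (flip (some s, 7)).1 ≤ radius (some s) + 1 := fun s => by
    rw [flip_seven, radius_parent]; simp [radius]; omega
  obtain ⟨_ | ⟨b, w⟩, j⟩ := x
  · exact le_rfl
  cases b
  · fin_cases j
    exacts [h0 _, h1 _, le_rfl, le_rfl, le_rfl, le_rfl, hb ⟨false, w⟩, h7 _]
  · fin_cases j
    · exact h0 _
    · exact h1 _
    · exact le_rfl
    · exact le_rfl
    · exact le_rfl
    · exact hb ⟨true, w⟩
    · cases w with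
      | first w =>
        change level (pred w).2 + 1 ≤ level w + 1 + 1 + 1
        rw [level_pred]; omega
    · exact h7 _

end Node

namespace BWLattice

variable {D : Type*} (L : BWLattice 8 D) (o : D)

theorem origin_rot_iterate (d : D) (n : ℕ) : L.origin (L.rot^[n] d) = L.origin d := by
  induction n with
  | zero => rfl
  | succ n ih => rw [Function.iterate_succ_apply', L.origin_rot, ih]

theorem exists_rot_iterate_eq {d e : D} (h : L.origin d = L.origin e) :
    ∃ i : Fin 8, L.rot^[i] d = e := by
  obtain ⟨i, rfl⟩ : Equiv.Perm.SameCycle L.rot d e := Quotient.exact h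
  have h8 : L.rot ^ 8 = 1 := by
    ext d; rw [← Equiv.Perm.iterate_eq_pow, rot_iterate_eight]; rfl
  refine ⟨⟨(i % 8).toNat, by omega⟩, ?_⟩
  rw [Equiv.Perm.iterate_eq_pow, ← zpow_natCast, Int.toNat_of_nonneg (by omega)]
  exact congrArg (fun f : Equiv.Perm D => f d) (zpow_eq_zpow_emod' i h8).symm

/-- The image in the lattice of a vertex of the ball model. -/
def placeVertex (u : Option (Sigma Node)) : L.Vertex := L.origin (L.placeDart o (u, 0))

theorem origin_placeDart (u : Option (Sigma Node)) (i : Fin 8) :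
    L.origin (L.placeDart o (u, i)) = L.placeVertex o u := by
  rw [placeDart_eq, origin_rot_iterate]; rfl

theorem target_placeDart (x : Option (Sigma Node) × Fin 8) :
    L.target (L.placeDart o x) = L.placeVertex o (Node.flip x).1 := by
  rw [TriangulatedSurface.target, ← placeDart_flip, ← L.origin_placeDart o _ (Node.flip x).2]

theorem placeDart_injective (u : Option (Sigma Node)) {i j : Fin 8}
    (h : L.placeDart o (u, i) = L.placeDart o (u, j)) : i = j := by
  rw [placeDart_eq, L.placeDart_eq o u j] at h
  exact Fin.ext (L.rot_iterate_injOn _ i.2 j.2 h)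

theorem exists_placeDart_eq {u : Option (Sigma Node)} {d : D}
    (h : L.origin d = L.placeVertex o u) : ∃ i, L.placeDart o (u, i) = d := by
  obtain ⟨i, hi⟩ := L.exists_rot_iterate_eq h.symm
  exact ⟨i, by rw [placeDart_eq, hi]⟩

theorem placeDart_dec (u : Option (Sigma Node)) (i : Fin 8) :
    L.placeDart o (u, Node.dec i) = L.rot.symm (L.placeDart o (u, i)) := by
  rw [Equiv.eq_symm_apply, placeDart_eq, L.placeDart_eq o u i]
  fin_cases i
  · exact L.rot_iterate_eight _
  all_goals rfl

theorem placeDart_turn (x : Option (Sigma Node) × Fin 8) :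
    L.placeDart o (Node.turn x) = L.next (L.placeDart o x) := by
  rw [Node.turn, placeDart_dec, Prod.mk.eta, placeDart_flip]; rfl

open Classical in
/-- The end point of the lift of the dart `d` to the ball model that starts at `u`. -/
noncomputable def step (u : Option (Sigma Node)) (d : D) : Option (Sigma Node) :=
  -- The value `u` is a default for darts that do not start at the image of `u`; the index `i` is
  -- unique otherwise.
  if h : ∃ i, L.placeDart o (u, i) = d then (Node.flip (u, h.choose)).1 else u

theorem step_placeDart (x : Option (Sigma Node) × Fin 8) :
    L.step o x.1 (L.placeDart o x) = (Node.flip x).1 := by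
  have h : ∃ i, L.placeDart o (x.1, i) = L.placeDart o x := ⟨x.2, rfl⟩
  rw [step, dif_pos h, L.placeDart_injective o x.1 (h.choose_spec.trans rfl : _ =
    L.placeDart o (x.1, x.2))]

/-- The end point of the lift of a path to the ball model that starts at `u`. -/
noncomputable def lift (u : Option (Sigma Node)) (l : List D) : Option (Sigma Node) :=
  l.foldl (L.step o) u

theorem lift_append (u : Option (Sigma Node)) (p q : List D) :
    L.lift o u (p ++ q) = L.lift o (L.lift o u p) q := List.foldl_append

theorem placeVertex_lift {u : Option (Sigma Node)} {w : L.Vertex} {l : List D}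
    (h : L.IsPath (L.placeVertex o u) w l) : L.placeVertex o (L.lift o u l) = w := by
  induction l generalizing u with
  | nil => exact h
  | cons d l ih =>
    obtain ⟨i, rfl⟩ := L.exists_placeDart_eq o h.1
    have h2 := h.2
    rw [target_placeDart, ← L.step_placeDart o (u, i)] at h2
    exact ih h2

theorem lift_rev {u : Option (Sigma Node)} {d : D} (h : L.origin d = L.placeVertex o u) :
    L.lift o u [d, L.rev d] = u := by
  obtain ⟨i, rfl⟩ := L.exists_placeDart_eq o h
  simp only [lift, List.foldl_cons, List.foldl_nil]
  rw [L.step_placeDart o (u, i), ← placeDart_flip, step_placeDart, Node.flip_flip]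

theorem lift_triangle {u : Option (Sigma Node)} {d : D} (h : L.origin d = L.placeVertex o u) :
    L.lift o u [d, L.next d, L.next (L.next d)] = u := by
  obtain ⟨i, rfl⟩ := L.exists_placeDart_eq o h
  have hs : ∀ x, L.step o x.1 (L.placeDart o x) = (Node.turn x).1 := L.step_placeDart o
  simp only [lift, List.foldl_cons, List.foldl_nil]
  rw [hs (u, i), ← placeDart_turn, hs, ← placeDart_turn, hs, Node.turn_pow_three]

/-- Back-and-forth edges and triangles lift to closed paths, by `Node.flip_flip` and
`Node.turn_pow_three`. -/
theorem lift_eq_of_homotopic {u : Option (Sigma Node)} {w : L.Vertex} {l l' : List D}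
    (h : L.Homotopic (L.placeVertex o u) w l l') : L.lift o u l = L.lift o u l' := by
  induction h with
  | refl x => rfl
  | symm x y _ ih => exact ih.symm
  | trans x y z _ _ h1 h2 => exact h1.trans h2
  | rel x y h =>
    obtain ⟨hx, -, p, q, d, rfl, h⟩ := h
    have key : ∀ t, (∀ u, L.origin d = L.placeVertex o u → L.lift o u (d :: t) = u) →
        x = p ++ d :: t ++ q → L.lift o u x = L.lift o u (p ++ q) := by
      rintro t ht rfl
      obtain ⟨y, hy, -⟩ := L.isPath_append_iff.1 hx
      obtain ⟨z, hz, hd⟩ := L.isPath_append_iff.1 hy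
      rw [lift_append, lift_append, lift_append, ht _ (hd.1.trans (L.placeVertex_lift o hz).symm)]
    rcases h with h | h
    · exact key _ (fun u => L.lift_rev o) h
    · exact key _ (fun u => L.lift_triangle o) h

/-- Connectedness of the covering: chains of parents join every model vertex to the center. -/
theorem exists_lift_eq (u : Option (Sigma Node)) :
    ∃ l, L.IsPath (L.placeVertex o none) (L.placeVertex o u) l ∧ L.lift o none l = u := by
  have key : ∀ {b : Bool} (w : Node b), (∃ l, L.IsPath (L.placeVertex o none)
      (L.placeVertex o w.parent.1) l ∧ L.lift o none l = w.parent.1) →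
      ∃ l, L.IsPath (L.placeVertex o none) (L.placeVertex o (some ⟨_, w⟩)) l ∧
        L.lift o none l = some ⟨_, w⟩ := by
    rintro b w ⟨l, hl, h⟩
    refine ⟨l ++ [L.placeDart o w.parent], L.isPath_append hl ⟨?_, ?_⟩, ?_⟩
    · exact L.origin_placeDart o _ _
    · rw [target_placeDart, Node.flip_parent]; rfl
    · rw [lift_append, h]
      exact (L.step_placeDart o w.parent).trans (by rw [Node.flip_parent])
  rcases u with _ | ⟨b, w⟩
  · exact ⟨[], rfl, rfl⟩
  · induction w with
    | base i => exact key _ ⟨[], rfl, rfl⟩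
    | @first b w ih => cases b <;> exact key _ ih
    | @second b w ih => cases b <;> exact key _ ih
    | @third b w ih => cases b <;> exact key _ ih
    | fourth w ih => exact key _ ih

/-- A connected covering of a simply connected surface is one-sheeted. A path `q` back to the center
lifts from both `u` and `u'` to paths ending at the model center; following `l'` from there returns
to both, so they agree. -/
theorem placeVertex_injective : Function.Injective (L.placeVertex o) := by
  intro u u' huu
  obtain ⟨l, hl, h⟩ := L.exists_lift_eq o u
  obtain ⟨l', hl', h'⟩ := L.exists_lift_eq o u'
  obtain ⟨q, hq, hh⟩ := L.exists_inverse hl'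
  rw [huu] at hl
  have e1 := L.lift_eq_of_homotopic o (L.simplyConnected _ _ (L.isPath_append hl hq))
  have e2 := L.lift_eq_of_homotopic o (L.simplyConnected _ _ (L.isPath_append hl' hq))
  have e3 := L.lift_eq_of_homotopic o hh
  have e4 := L.lift_eq_of_homotopic o (huu ▸ hh)
  rw [lift_append, h] at e1
  rw [lift_append, h'] at e2
  rw [lift_append, e2] at e3
  rw [lift_append, e1] at e4
  exact e4.symm.trans e3

theorem adj_iff {u u' : Option (Sigma Node)} :
    L.graph.Adj (L.placeVertex o u) (L.placeVertex o u') ↔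
      u ≠ u' ∧ ∃ i, (Node.flip (u, i)).1 = u' := by
  rw [TriangulatedSurface.graph, SimpleGraph.fromRel_adj, (L.placeVertex_injective o).ne_iff]
  refine and_congr_right fun _ => ⟨fun h => ?_, ?_⟩
  · obtain ⟨d, hd, hd'⟩ : ∃ d, L.origin d = L.placeVertex o u ∧
        L.target d = L.placeVertex o u' := by
      rcases h with h | ⟨d, hd, hd'⟩
      · exact h
      · exact ⟨L.rev d, hd', (L.target_rev d).trans hd⟩
    obtain ⟨i, rfl⟩ := L.exists_placeDart_eq o hd
    rw [target_placeDart] at hd'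
    exact ⟨i, L.placeVertex_injective o hd'⟩
  · rintro ⟨i, rfl⟩
    exact .inl ⟨_, L.origin_placeDart o u i, L.target_placeDart o (u, i)⟩

theorem exists_eq_placeVertex_of_adj {u : Option (Sigma Node)} {v : L.Vertex}
    (h : L.graph.Adj (L.placeVertex o u) v) : ∃ u', L.placeVertex o u' = v := by
  rw [TriangulatedSurface.graph, SimpleGraph.fromRel_adj] at h
  obtain ⟨d, hd, hd'⟩ : ∃ d, L.origin d = L.placeVertex o u ∧ L.target d = v := by
    rcases h.2 with h | ⟨d, hd, hd'⟩
    · exact h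
    · exact ⟨L.rev d, hd', (L.target_rev d).trans hd⟩
  obtain ⟨i, rfl⟩ := L.exists_placeDart_eq o hd
  exact ⟨_, (L.target_placeDart o (u, i)).symm.trans hd'⟩

theorem placeVertex_surjective : Function.Surjective (L.placeVertex o) := by
  intro v
  obtain ⟨p⟩ := L.connected.preconnected (L.placeVertex o none) v
  suffices ∀ {x y : L.Vertex} (p : L.graph.Walk x y), (∃ u, L.placeVertex o u = x) →
    ∃ u, L.placeVertex o u = y from this p ⟨_, rfl⟩
  intro x y p
  induction p with
  | nil => exact id
  | cons h p ih =>
    rintro ⟨u, rfl⟩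
    exact ih (L.exists_eq_placeVertex_of_adj o h)

theorem radius_le_of_walk {x y : L.Vertex} (p : L.graph.Walk x y) {u u' : Option (Sigma Node)}
    (hu : L.placeVertex o u = x) (hu' : L.placeVertex o u' = y) :
    Node.radius u' ≤ Node.radius u + p.length := by
  induction p generalizing u with
  | nil => rw [L.placeVertex_injective o (hu.trans hu'.symm)]; exact Nat.le_add_right _ _
  | cons h p ih =>
    subst hu
    obtain ⟨u1, rfl⟩ := L.exists_eq_placeVertex_of_adj o h
    obtain ⟨-, i, hi⟩ := (L.adj_iff o).1 h
    have h1 := ih rfl hu'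
    have h2 := Node.radius_flip_le (u, i)
    rw [hi] at h2
    rw [SimpleGraph.Walk.length_cons]
    simp only at h2
    omega

/-- Parents give a path of length `radius u`, and no edge changes the radius enough to allow a
shorter one. -/
theorem dist_placeVertex (u : Option (Sigma Node)) :
    L.graph.dist (L.placeVertex o none) (L.placeVertex o u) = Node.radius u := by
  apply le_antisymm
  · have key : ∀ {b : Bool} (w : Node b),
        L.graph.dist (L.placeVertex o none) (L.placeVertex o w.parent.1) ≤
          Node.radius w.parent.1 →
        L.graph.dist (L.placeVertex o none) (L.placeVertex o (some ⟨_, w⟩)) ≤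
          Node.radius (some ⟨_, w⟩) := by
      intro b w h
      rw [Node.radius_parent] at h
      have hadj : L.graph.Adj (L.placeVertex o w.parent.1) (L.placeVertex o (some ⟨_, w⟩)) := by
        refine (L.adj_iff o).2 ⟨fun e => ?_, w.parent.2, by rw [Prod.mk.eta, Node.flip_parent]⟩
        have := Node.radius_parent w
        rw [e] at this
        exact (Nat.succ_ne_self _) this
      have := L.connected.dist_triangle (u := L.placeVertex o none)
        (v := L.placeVertex o w.parent.1) (w := L.placeVertex o (some ⟨_, w⟩))
      rw [SimpleGraph.dist_eq_one_iff_adj.2 hadj] at this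
      exact this.trans (Nat.add_le_add_right h 1)
    rcases u with _ | ⟨b, w⟩
    · simp
    · induction w with
      | base i => exact key _ (by change L.graph.dist _ (L.placeVertex o none) ≤ _; simp)
      | @first b w ih => cases b <;> exact key _ ih
      | @second b w ih => cases b <;> exact key _ ih
      | @third b w ih => cases b <;> exact key _ ih
      | fourth w ih => exact key _ ih
  · obtain ⟨p, hp⟩ := L.connected.exists_walk_length_eq_dist
      (L.placeVertex o none) (L.placeVertex o u)
    rw [← hp]
    exact (L.radius_le_of_walk o p rfl rfl).trans (by simp [Node.radius])

end BWLattice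

/-! ### Circles of the model, and spheres as iterated shifts -/

/-- If `g` moves each block one place on, ending at the head of the next block, and the blocks
themselves are cyclically permuted by `f`, then `g` is the cyclic successor on the concatenation. It
is applied with the children of a vertex as the block. -/
theorem List.rotate_one_flatMap {α β : Type*} {f : α → α} {g : β → β} {x : α → β}
    {t : α → List β} (hg : ∀ a, (x a :: t a).map g = t a ++ [x (f a)]) {l : List α}
    (hl : l.rotate 1 = l.map f) :
    (l.flatMap fun a => x a :: t a).rotate 1 = (l.flatMap fun a => x a :: t a).map g := by
  have key : ∀ (l : List α) (a b : α), l ++ [b] = (a :: l).map f →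
      ((a :: l).flatMap fun a => x a :: t a) ++ [x b] =
        x a :: (a :: l).flatMap fun a => t a ++ [x (f a)] := by
    intro l
    induction l with
    | nil => intro a b h; simp at h; simp [h]
    | cons c l ih =>
      intro a b h
      obtain ⟨rfl, h⟩ : c = f a ∧ l ++ [b] = (c :: l).map f := by simpa using h
      rw [List.flatMap_cons, List.append_assoc, ih _ _ h]
      simp
  cases l with
  | nil => rfl
  | cons a l =>
    have h := key l a a (by simpa using hl)
    simp only [List.flatMap_cons, List.cons_append, List.cons.injEq, true_and] at h
    rw [List.flatMap_cons, List.cons_append, List.rotate_cons_succ, List.rotate_zero, h,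
      ← List.cons_append, List.map_append, hg, List.map_flatMap]
    simp [hg]

namespace Node

/-- The vertices at distance `n + 1` from the center of the ball model, in clockwise order. -/
def circle : ℕ → List (Sigma Node)
  | 0 => [⟨_, base 7⟩, ⟨_, base 6⟩, ⟨_, base 5⟩, ⟨_, base 4⟩, ⟨_, base 3⟩, ⟨_, base 2⟩,
      ⟨_, base 1⟩, ⟨_, base 0⟩]
  | n + 1 => (circle n).flatMap fun s => children _ (succ s.2).2

theorem children_eq_cons {b : Bool} (w : Node b) :
    children b w = ⟨_, first w⟩ :: (children b w).tail := by cases b <;> rfl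

theorem map_succ_children {b : Bool} (w : Node b) :
    (children b w).map (fun s => succ s.2) = (children b w).tail ++ [⟨_, first (succ w).2⟩] := by
  cases b <;> rfl

theorem circle_succ (n : ℕ) : circle (n + 1) =
    ((circle n).map fun s => succ s.2).flatMap fun s => children _ s.2 := by
  rw [circle, List.flatMap_map]

theorem rotate_one_circle (n : ℕ) :
    (circle n).rotate 1 = (circle n).map fun s => succ s.2 := by
  induction n with
  | zero => rfl
  | succ n ih =>
    rw [circle_succ]
    have := List.rotate_one_flatMap (f := fun s : Sigma Node => succ s.2)
      (g := fun s : Sigma Node => succ s.2) (x := fun s => ⟨_, first s.2⟩)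
      (t := fun s => (children _ s.2).tail)
      (fun s => by rw [← children_eq_cons]; exact map_succ_children s.2)
      (l := (circle n).map fun s => succ s.2) (by rw [← List.map_rotate, ih])
    simpa only [← children_eq_cons] using this

theorem mem_children_level {b : Bool} {w : Node b} {s : Sigma Node} (h : s ∈ children b w) :
    level s.2 = level w + 1 := by
  cases b <;> simp only [children, List.mem_cons, List.not_mem_nil, or_false] at h
  · rcases h with rfl | rfl | rfl | rfl <;> rfl
  · rcases h with rfl | rfl | rfl <;> rfl

theorem mem_children_parent {b : Bool} {w : Node b} {s : Sigma Node} (h : s ∈ children b w) :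
    (parent s.2).1 = some ⟨b, w⟩ := by
  cases b <;> simp only [children, List.mem_cons, List.not_mem_nil, or_false] at h
  · rcases h with rfl | rfl | rfl | rfl <;> rfl
  · rcases h with rfl | rfl | rfl <;> rfl

theorem mem_children_of_parent {b : Bool} {w : Node b} {s : Sigma Node}
    (h : (parent s.2).1 = some ⟨b, w⟩) : s ∈ children b w := by
  obtain ⟨c, v⟩ := s
  cases v with
  | base i => cases h
  | @first b v => cases b <;> cases h <;> simp [children]
  | @second b v => cases b <;> cases h <;> simp [children]
  | @third b v => cases b <;> cases h <;> simp [children]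
  | fourth v => cases h; simp [children]

theorem mem_circle {n : ℕ} {s : Sigma Node} : s ∈ circle n ↔ level s.2 = n := by
  induction n generalizing s with
  | zero =>
    obtain ⟨b, w⟩ := s
    cases w <;> simp [circle, level]
    rename_i i
    revert i
    decide
  | succ n ih =>
    rw [circle, List.mem_flatMap]
    constructor
    · rintro ⟨v, hv, hs⟩
      rw [mem_children_level hs, level_succ, ih.1 hv]
    · intro h
      obtain ⟨v, hv⟩ : ∃ v, (parent s.2).1 = some v := by
        rcases hp : (parent s.2).1 with _ | v
        · have := radius_parent s.2
          rw [hp, h] at this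
          cases this
        · exact ⟨v, rfl⟩
      have hl := radius_parent s.2
      rw [hv, h] at hl
      refine ⟨pred v.2, ih.2 ?_, ?_⟩
      · rw [level_pred]; exact Nat.succ_injective hl
      · rw [succ_pred]; exact mem_children_of_parent hv

/-- Different blocks are disjoint because a child determines its parent and `succ` is injective. -/
theorem nodup_circle (n : ℕ) : (circle n).Nodup := by
  induction n with
  | zero => simp [circle]
  | succ n ih =>
    rw [circle, List.nodup_flatMap]
    refine ⟨fun s _ => ?_, ih.imp fun {s v} hsv => ?_⟩
    · rcases succ s.2 with ⟨_ | _, w⟩ <;> simp [children]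
    · intro c hc hc'
      have h := Option.some_injective _ ((mem_children_parent hc).symm.trans
        (mem_children_parent hc'))
      have h : succ s.2 = succ v.2 := h
      exact hsv ((pred_succ s.2).symm.trans (h ▸ pred_succ v.2))

end Node

namespace BWLattice

variable {D : Type*} (L : BWLattice 8 D)

/-- The path around the circle of radius `n + 1`. -/
def circlePath (o : D) (n : ℕ) : List D := (Node.circle n).map fun s => L.place o s.2

theorem cyclicCorners_circlePath (o : D) (n : ℕ) : cyclicCorners (L.circlePath o n) =
    (Node.circle n).map fun s => (L.place o s.2, L.place o s.2.succ.2) := by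
  rw [cyclicCorners, circlePath, ← List.map_rotate, Node.rotate_one_circle, List.map_map,
    List.zip_map']
  rfl

theorem isRightConvexClosed_circlePath (o : D) : L.IsRightConvexClosed (L.circlePath o 0) := by
  refine ⟨by simp [circlePath, Node.circle], fun c hc => ?_⟩
  rw [cyclicCorners_circlePath] at hc
  obtain ⟨s, -, rfl⟩ := List.mem_map.1 hc
  rw [convexCorner_iff]
  have := L.place_succ o s.2
  rcases h : s.2.succ with ⟨_ | _, v⟩ <;> rw [h] at this
  · exact .inl this
  · exact .inr this

/-- The corner between the edges of `w` and its successor lies at the successor, so the fan consists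
of the successor's children. This explains the `succ` in the recursion for `circle`. -/
theorem shiftCorner_place (o : D) {b : Bool} (w : Node b) :
    L.shiftCorner (L.place o w, L.place o w.succ.2) =
      (Node.children _ w.succ.2).map fun s => L.place o s.2 := by
  have := L.place_succ o w
  rcases h : w.succ with ⟨_ | _, v⟩ <;> rw [h] at this
  · exact L.shiftCorner_of_turn_two this
  · exact L.shiftCorner_of_turn_three this

theorem shiftClosed_circlePath (o : D) (n : ℕ) :
    L.shiftClosed (L.circlePath o n) = L.circlePath o (n + 1) := by
  rw [shiftClosed, cyclicCorners_circlePath, circlePath, Node.circle, List.map_flatMap,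
    List.flatMap_map]
  simp only [shiftCorner_place]

theorem iterate_shiftClosed_circlePath (o : D) (n : ℕ) :
    L.shiftClosed^[n] (L.circlePath o 0) = L.circlePath o n := by
  induction n with
  | zero => rfl
  | succ n ih => rw [Function.iterate_succ_apply', ih, shiftClosed_circlePath]

theorem traverses_circlePath (o : D) (n : ℕ) :
    L.Traverses (L.circlePath o n) (L.sphere (L.origin o) (n + 1)) := by
  have h : (L.circlePath o n).map L.origin =
      (Node.circle n).map fun s => L.placeVertex o (some s) := by
    rw [circlePath, List.map_map]; rfl
  rw [Traverses, h]
  refine ⟨(Node.nodup_circle n).map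
    ((L.placeVertex_injective o).comp (Option.some_injective _)), ?_⟩
  ext v
  obtain ⟨u, rfl⟩ := L.placeVertex_surjective o v
  have hd : L.graph.dist (L.origin o) (L.placeVertex o u) = Node.radius u :=
    L.dist_placeVertex o u
  simp only [Set.mem_ofPred_eq, List.mem_map, (L.placeVertex_injective o).eq_iff, sphere, hd,
    Node.mem_circle]
  constructor
  · rintro ⟨s, hs, rfl⟩
    rw [Node.radius, hs]
  · intro h
    rcases u with _ | s
    · cases h
    · exact ⟨s, Nat.succ_injective h, rfl⟩

theorem Traverses.ncard_eq {γ : List D} {S : Set L.Vertex} (h : L.Traverses γ S) :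
    S.Finite ∧ S.ncard = γ.length := by
  classical
  obtain ⟨h1, rfl⟩ := h
  have : {v | v ∈ γ.map L.origin} = ((γ.map L.origin).toFinset : Set L.Vertex) := by
    ext v; rw [List.coe_toFinset]
  rw [this, Set.ncard_coe_finset, List.toFinset_card_of_nodup h1, List.length_map]
  exact ⟨Finset.finite_toSet _, rfl⟩

theorem sphere_zero (o : L.Vertex) : L.sphere o 0 = {o} := by
  ext v
  rw [sphere, Set.mem_ofPred_eq, L.connected.dist_eq_zero_iff]
  exact eq_comm

end BWLattice

theorem theorem6 {D : Type*} (L : BWLattice 8 D) :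
    (∀ γ : List D, L.IsRightConvexClosed γ →
      (∀ n : ℕ, L.IsRightConvexClosed (L.shiftClosed^[n] γ)) ∧
      ((fun n : ℕ => ((L.shiftClosed^[n + 1] γ).length : ℝ)) ~[atTop]
        fun n : ℕ => (2 + √3) * ((L.shiftClosed^[n] γ).length : ℝ)) ∧
      ∃ c : ℝ, 0 < c ∧
        (fun n : ℕ => ((L.shiftClosed^[n] γ).length : ℝ)) ~[atTop]
          fun n : ℕ => c * (2 + √3) ^ n) ∧
    (∀ γ : List D, L.IsRightConvexOpen γ →
      (∀ n : ℕ, L.IsRightConvexOpen (L.shiftOpen^[n] γ)) ∧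
      ((fun n : ℕ => ((L.shiftOpen^[n + 1] γ).length : ℝ)) ~[atTop]
        fun n : ℕ => (2 + √3) * ((L.shiftOpen^[n] γ).length : ℝ)) ∧
      ∃ c : ℝ, 0 < c ∧
        (fun n : ℕ => ((L.shiftOpen^[n] γ).length : ℝ)) ~[atTop]
          fun n : ℕ => c * (2 + √3) ^ n) ∧
    (∀ o : L.Vertex,
      (∃ γ : List D, L.IsRightConvexClosed γ ∧
        ∀ n : ℕ, L.Traverses (L.shiftClosed^[n] γ) (L.sphere o (n + 1))) ∧
      (∀ r : ℕ, (L.sphere o r).Finite ∧ (L.sphere o r).Nonempty) ∧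
      ((fun r : ℕ => ((L.sphere o (r + 1)).ncard : ℝ)) ~[atTop]
        fun r : ℕ => (2 + √3) * ((L.sphere o r).ncard : ℝ)) ∧
      (∀ k : ℕ, 1 ≤ k → ∃ C : ℝ, 0 < C ∧
        Tendsto (fun r : ℕ => ((L.sphere o r).ncard : ℝ) /
          ((2 + √3) ^ ((r : ℤ) - (k : ℤ)) * ((L.sphere o k).ncard : ℝ))) atTop (nhds C)) ∧
      (∀ ε : ℝ, 0 < ε → ∃ K : ℕ, ∀ k r : ℕ, K ≤ k → k ≤ r →
        |((L.sphere o r).ncard : ℝ) /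
          ((2 + √3) ^ ((r : ℤ) - (k : ℤ)) * ((L.sphere o k).ncard : ℝ)) - 1| < ε)) := by
  have hpos : (0 : ℝ) < 2 + √3 := by positivity
  refine ⟨fun γ h => ?_, fun γ h => ?_, fun o => ?_⟩
  · obtain ⟨c, hc, ht⟩ := L.tendsto_length_shiftClosed h
    exact ⟨L.isRightConvexClosed_iterate h, isEquivalent_succ_of_tendsto hc ht, c, hc,
      isEquivalent_mul_pow_of_tendsto hc ht⟩
  · obtain ⟨c, hc, ht⟩ := L.tendsto_length_shiftOpen h
    exact ⟨L.isRightConvexOpen_iterate h, isEquivalent_succ_of_tendsto hc ht, c, hc,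
      isEquivalent_mul_pow_of_tendsto hc ht⟩
  · obtain ⟨d, rfl⟩ : ∃ d, L.origin d = o := Quotient.exists_rep o
    have hγ := L.isRightConvexClosed_circlePath d
    have htr : ∀ n, L.Traverses (L.shiftClosed^[n] (L.circlePath d 0))
        (L.sphere (L.origin d) (n + 1)) := fun n => by
      rw [L.iterate_shiftClosed_circlePath]; exact L.traverses_circlePath d n
    have hne : ∀ n, (L.sphere (L.origin d) (n + 1)).ncard ≠ 0 := fun n => by
      rw [(htr n).ncard_eq.2]
      exact fun h => (L.isRightConvexClosed_iterate hγ n).1 (List.length_eq_zero_iff.1 h)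
    obtain ⟨c, hc, ht⟩ := L.tendsto_length_shiftClosed hγ
    obtain ⟨c, hc, ht⟩ : ∃ c : ℝ, 0 < c ∧ Tendsto (fun r : ℕ =>
        ((L.sphere (L.origin d) r).ncard : ℝ) / (2 + √3) ^ r) atTop (nhds c) := by
      -- The `n`-th shift traverses the sphere of radius `n + 1`, which costs one factor `2 + √3` in
      -- the constant.
      refine ⟨c / (2 + √3), by positivity, (tendsto_add_atTop_iff_nat 1).1 ?_⟩
      refine (ht.div_const (2 + √3)).congr fun n => ?_
      rw [(htr n).ncard_eq.2, pow_succ, div_div]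
    refine ⟨⟨_, hγ, htr⟩, fun r => ?_, isEquivalent_succ_of_tendsto hc ht, fun k hk => ?_,
      fun ε hε => eventually_abs_div_zpow_sub_mul_lt hpos hc ht hε⟩
    · cases r with
      | zero => rw [L.sphere_zero]; exact ⟨Set.finite_singleton _, Set.singleton_nonempty _⟩
      | succ r => exact ⟨(htr r).ncard_eq.1, Set.nonempty_of_ncard_ne_zero (hne r)⟩
    · refine ⟨_, ?_, tendsto_div_zpow_sub_mul hpos ht k⟩
      have : 0 < (L.sphere (L.origin d) k).ncard := by
        obtain ⟨k, rfl⟩ := Nat.exists_eq_succ_of_ne_zero (Nat.one_le_iff_ne_zero.1 hk)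
        exact Nat.pos_of_ne_zero (hne k)
      positivity
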